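/- Let $G$ be a compact quantum group, and let $\operatorname{Rep}G$ be the category of finite dimensional unitary representations of $G$, with tensor product $\times$, trivial representation $\mathbf 1$ on $\mathbb C$, and intertwiners $\operatorname{Mor}(U,V)$ as morphisms; we suppress its associativity and unit isomorphisms. Let $(U_\alpha)_\alpha$ contain exactly one representative of each class of irreducible unitary representations, and let $e$ be the index with $U_e=\mathbf 1$. Let $A$ be a (not necessarily unital) C$^*$-algebra and $\operatorname{Hilb}A$ the category of C$^*$-correspondences over $A$, i.e. right Hilbert $A$-modules with a nondegenerate left action of $A$ by adjointable operators; its morphisms are the adjointable $A$-bilinear maps. A *weak unitary tensor functor* $F\colon\operatorname{Rep}G\to\operatorname{Hilb}A$ is a linear functor together with natural $A$-bilinear isometries $F_2\colon F(U)\otimes_AF(V)\to F(U\times V)$ (not assumed adjointable) such that: $F(\mathbf 1)=A$; $F(T)^*=F(T^*)$ for all morphisms $T$; $F_2(a\otimes X)=aX$ and $F_2(X\otimes a)=Xa$ for $a\in A=F(\mathbf 1)$ and $X\in F(U)$; $F_2(F_2\otimes\iota)=F_2(\iota\otimes F_2)$ on $F(U)\otimes_AF(V)\otimes_AF(W)$;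 and for all $U,V$ and $X\in F(U)$ the map $S_{X,V}\colon F(V)\to F(U\times V)$, $Y\mapsto F_2(X\otimes Y)$, is adjointable, and $S_{X,V\times W}^*F_2=F_2(S_{X,V}^*\otimes\iota)$ on $F(U\times V)\otimes_AF(W)$ for all $W$. Assume that we are given correspondences $M_\alpha\in\operatorname{Hilb}A$ and linear maps $\varphi=\varphi^\gamma_{\alpha,\beta}$ from $\operatorname{Mor}(U_\alpha\times U_\beta,U_\gamma)$ to the space of bounded $A$-bilinear maps $M_\alpha\otimes_AM_\beta\to M_\gamma$ such that the following conditions hold. (i) $M_e=A$. (ii) If $(T_1,\dots,T_n)\colon U_\alpha\times U_\beta\to\bigoplus_{i=1}^nU_{\gamma_i}$ is a unitary morphism, then $(\varphi(T_1),\dots,\varphi(T_n))\colon M_\alpha\otimes_AM_\beta\to\bigoplus_{i=1}^nM_{\gamma_i}$ is isometric. (iii) $\varphi^\beta_{e,\beta}(\iota)(a\otimes X)=aX$ for $a\in A$, $X\in M_\beta$, and $\varphi^\alpha_{\alpha,e}(\iota)(X\otimes a)=Xa$ for $X\in M_\alpha$, $a\in A$. (iv) If $\sum_iS_i(T_i\otimes\iota)=\sum_jS'_j(\iota\otimes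 T'_j)$ as morphisms $U_\alpha\times U_\beta\times U_\gamma\to U_\delta$, for finitely many morphisms $T_i\colon U_\alpha\times U_\beta\to U_{\alpha_i}$, $S_i\colon U_{\alpha_i}\times U_\gamma\to U_\delta$, $T'_j\colon U_\beta\times U_\gamma\to U_{\beta_j}$, $S'_j\colon U_\alpha\times U_{\beta_j}\to U_\delta$, then $\sum_i\varphi(S_i)(\varphi(T_i)\otimes\iota)=\sum_j\varphi(S'_j)(\iota\otimes\varphi(T'_j))$ as maps $M_\alpha\otimes_AM_\beta\otimes_AM_\gamma\to M_\delta$. (v) For all $X\in M_\alpha$ and $T\colon U_\alpha\times U_\beta\to U_\gamma$ the map $S_X[T]\colon M_\beta\to M_\gamma$, $Y\mapsto\varphi(T)(X\otimes Y)$, is adjointable; and if $\sum_i(\iota\otimes S_i)(T_i^*\otimes\iota)=\sum_jP_j^*R_j$ as morphisms $U_\gamma\times U_\delta\to U_\alpha\times U_\eta$, for finitely many morphisms $T_i\colon U_\alpha\times U_{\beta_i}\to U_\gamma$, $S_i\colon U_{\beta_i}\times U_\delta\to U_\eta$, $R_j\colon U_\gamma\times U_\delta\to U_{\gamma_j}$,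 $P_j\colon U_\alpha\times U_\eta\to U_{\gamma_j}$, then $\sum_i\varphi(S_i)(S_X[T_i]^*\otimes\iota)=\sum_jS_X[P_j]^*\varphi(R_j)$ as maps $M_\gamma\otimes_AM_\delta\to M_\eta$, for every $X\in M_\alpha$. Then there exists a weak unitary tensor functor $F\colon\operatorname{Rep}G\to\operatorname{Hilb}A$ such that $F(U_\alpha)=M_\alpha$ for all $\alpha$ and $F(T)F_2=\varphi^\gamma_{\alpha,\beta}(T)$ for all $T\in\operatorname{Mor}(U_\alpha\times U_\beta,U_\gamma)$, and it is unique up to a natural unitary monoidal isomorphism. Such an isomorphism can be chosen to be the identity on every $M_\alpha$. Here equalities between objects ($U_e=\mathbf 1$, $M_e=A$, $F(\mathbf 1)=A$, $F(U_\alpha)=M_\alpha$) are understood as specified unitary isomorphisms (of representations, respectively of correspondences); the resulting identifications of $F(\mathbf 1)$, $F(U_e)$, $M_e$ and $A$ agree, and for two functors $F,F'$ the isomorphism $F\cong F'$ is compatible with the identifications of $F(U_\alpha)$ and $F'(U_\alpha)$ with $M_\alpha$. -/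

import Mathlib

open scoped TensorProduct

/-! ## Finite dimensional unitary representations of a compact quantum group

A compact quantum group `G` is given by its Hopf `*`-algebra `O = ℂ[G]` of matrix coefficients. -/

section Representations

universe u

variable (O : Type u) [Ring O] [StarRing O] [HopfAlgebra ℂ O] [StarModule ℂ O]

/-- A finite dimensional unitary representation of `G`: a finite dimensional Hilbert space `H` and
a unitary element `U` of `B(H) ⊗ ℂ[G]` with `(ι ⊗ Δ)(U) = U₁₂ U₁₃`. -/
structure QRep where
  /-- the underlying Hilbert space -/
  H : Type
  [instNormed : NormedAddCommGroup H]
  [instInner : InnerProductSpace ℂ H]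
  [instFin : FiniteDimensional ℂ H]
  /-- the unitary in `B(H) ⊗ ℂ[G]` -/
  U : Module.End ℂ H ⊗[ℂ] O
  unitary : U ∈ unitary (Module.End ℂ H ⊗[ℂ] O)
  comul : Algebra.TensorProduct.map (AlgHom.id ℂ (Module.End ℂ H)) (Bialgebra.comulAlgHom ℂ O) U
    = Algebra.TensorProduct.map (AlgHom.id ℂ (Module.End ℂ H))
        (Algebra.TensorProduct.includeLeft : O →ₐ[ℂ] O ⊗[ℂ] O) U
      * Algebra.TensorProduct.map (AlgHom.id ℂ (Module.End ℂ H))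
        (Algebra.TensorProduct.includeRight : O →ₐ[ℂ] O ⊗[ℂ] O) U

attribute [instance] QRep.instNormed QRep.instInner QRep.instFin

/-- `O` is the Hopf `*`-algebra `ℂ[G]` of a compact quantum group `G`: the comultiplication is a
`*`-homomorphism and `O` is linearly spanned by the matrix coefficients `(ω ⊗ ι)(U)` of its finite
dimensional unitary representations. -/
class CompactQuantumGroup : Prop where
  comul_star : ∀ a : O, Coalgebra.comul (R := ℂ) (star a) = star (Coalgebra.comul (R := ℂ) a)
  span_coeff : Submodule.span ℂ {a : O | ∃ (V : QRep O) (ω : Module.End ℂ V.H →ₗ[ℂ] ℂ),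
    a = TensorProduct.lid ℂ O (ω.rTensor O V.U)} = ⊤

variable {O}

namespace QRep

section Aux

variable {R : Type*} [CommRing R] {H K L H' K' L' : Type*}
  [AddCommGroup H] [Module R H] [AddCommGroup K] [Module R K] [AddCommGroup L] [Module R L]
  [AddCommGroup H'] [Module R H'] [AddCommGroup K'] [Module R K']
  [AddCommGroup L'] [Module R L'] {B C : Type*} [Ring B] [Algebra R B] [Ring C] [Algebra R C]

/-- The product `(S ⊗ a)(T ⊗ b) = ST ⊗ ab` of operator-valued elements, for operators between
possibly different spaces. -/
noncomputable def pmul : (K →ₗ[R] L) ⊗[R] B →ₗ[R] (H →ₗ[R] K) ⊗[R] B →ₗ[R]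
    (H →ₗ[R] L) ⊗[R] B :=
  TensorProduct.map₂ (LinearMap.llcomp R H K L) (LinearMap.mul R B)

theorem pmul_tmul (S : K →ₗ[R] L) (a : B) (T : H →ₗ[R] K) (b : B) :
    pmul (S ⊗ₜ[R] a) (T ⊗ₜ[R] b) = (S ∘ₗ T) ⊗ₜ[R] (a * b) := rfl

theorem pmul_eq_mul (X Y : Module.End R H ⊗[R] B) : pmul X Y = X * Y := by
  induction X with
  | zero => simp
  | add X X' h h' => simp only [map_add, LinearMap.add_apply, add_mul, h, h']
  | tmul S a =>
    induction Y with
    | zero => simp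
    | add Y Y' h h' => simp only [map_add, mul_add, h, h']
    | tmul T b => rw [pmul_tmul, Algebra.TensorProduct.tmul_mul_tmul, Module.End.mul_eq_comp]

theorem pmul_assoc (X : (L →ₗ[R] L') ⊗[R] B) (Y : (K →ₗ[R] L) ⊗[R] B)
    (Z : (H →ₗ[R] K) ⊗[R] B) : pmul (pmul X Y) Z = pmul X (pmul Y Z) := by
  induction X with
  | zero => simp
  | add X X' h h' => simp only [map_add, LinearMap.add_apply, h, h']
  | tmul S a =>
    induction Y with
    | zero => simp
    | add Y Y' h h' => simp only [map_add, LinearMap.add_apply, h, h']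
    | tmul T b =>
      induction Z with
      | zero => simp
      | add Z Z' h h' => simp only [map_add, h, h']
      | tmul P c => simp only [pmul_tmul, LinearMap.comp_assoc, mul_assoc]

theorem pmul_one (X : (H →ₗ[R] K) ⊗[R] B) : pmul X (1 : Module.End R H ⊗[R] B) = X := by
  rw [Algebra.TensorProduct.one_def]
  induction X with
  | zero => simp
  | add X X' h h' => simp only [map_add, LinearMap.add_apply, h, h']
  | tmul S a => rw [pmul_tmul, mul_one]; rfl

theorem one_pmul (X : (H →ₗ[R] K) ⊗[R] B) : pmul (1 : Module.End R K ⊗[R] B) X = X := by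
  rw [Algebra.TensorProduct.one_def]
  induction X with
  | zero => simp
  | add X X' h h' => simp only [map_add, h, h']
  | tmul S a => rw [pmul_tmul, one_mul]; rfl

variable (R H K) in
/-- `X ↦ X₁₃`. -/
noncomputable def leg13 : Module.End R H ⊗[R] B →ₐ[R] Module.End R (H ⊗[R] K) ⊗[R] B :=
  Algebra.TensorProduct.map (Module.End.rTensorAlgHom R H K) (AlgHom.id R B)

variable (R H K) in
/-- `X ↦ X₂₃`. -/
noncomputable def leg23 : Module.End R K ⊗[R] B →ₐ[R] Module.End R (H ⊗[R] K) ⊗[R] B :=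
  Algebra.TensorProduct.map (Module.End.lTensorAlgHom R K H) (AlgHom.id R B)

theorem leg13_tmul (S : Module.End R H) (b : B) :
    leg13 R H K (S ⊗ₜ[R] b) = (S.rTensor K : Module.End R (H ⊗[R] K)) ⊗ₜ[R] b := rfl

theorem leg23_tmul (S : Module.End R K) (b : B) :
    leg23 R H K (S ⊗ₜ[R] b) = (S.lTensor H : Module.End R (H ⊗[R] K)) ⊗ₜ[R] b := rfl

/-- The bilinear map with `(S ⊗ a, T ⊗ b) ↦ (S ⊗ T) ⊗ ab`, that is `(X, Y) ↦ X₁₃ Y₂₃` for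
operators between possibly different spaces. -/
noncomputable def box : (H →ₗ[R] K) ⊗[R] B →ₗ[R] (H' →ₗ[R] K') ⊗[R] B →ₗ[R]
    (H ⊗[R] H' →ₗ[R] K ⊗[R] K') ⊗[R] B :=
  TensorProduct.map₂ (TensorProduct.mapBilinear (RingHom.id R) H H' K K') (LinearMap.mul R B)

theorem box_tmul (S : H →ₗ[R] K) (a : B) (T : H' →ₗ[R] K') (b : B) :
    box (S ⊗ₜ[R] a) (T ⊗ₜ[R] b) = TensorProduct.map S T ⊗ₜ[R] (a * b) := rfl

theorem leg_mul_leg (X : Module.End R H ⊗[R] B) (Y : Module.End R K ⊗[R] B) :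
    leg13 R H K X * leg23 R H K Y = box X Y := by
  induction X with
  | zero => simp
  | add X X' h h' => rw [map_add, add_mul, h, h', map_add, LinearMap.add_apply]
  | tmul S a =>
    induction Y with
    | zero => simp
    | add Y Y' h h' => rw [map_add, mul_add, h, h', map_add]
    | tmul T b =>
      rw [leg13_tmul, leg23_tmul, box_tmul, Algebra.TensorProduct.tmul_mul_tmul,
        Module.End.mul_eq_comp, LinearMap.rTensor_comp_lTensor]

theorem pmul_box (S : K →ₗ[R] L) (T : K' →ₗ[R] L') (X : (H →ₗ[R] K) ⊗[R] B)
    (Y : (H' →ₗ[R] K') ⊗[R] B) :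
    pmul (TensorProduct.map S T ⊗ₜ[R] 1) (box X Y)
      = box (pmul (S ⊗ₜ[R] 1) X) (pmul (T ⊗ₜ[R] 1) Y) := by
  induction X with
  | zero => simp
  | add X X' h h' => simp only [map_add, LinearMap.add_apply, h, h']
  | tmul P a =>
    induction Y with
    | zero => simp
    | add Y Y' h h' => simp only [map_add, h, h']
    | tmul Q b => simp only [box_tmul, pmul_tmul, TensorProduct.map_comp, one_mul]

theorem box_pmul (S : H →ₗ[R] K) (T : H' →ₗ[R] K') (X : (K →ₗ[R] L) ⊗[R] B)
    (Y : (K' →ₗ[R] L') ⊗[R] B) :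
    pmul (box X Y) (TensorProduct.map S T ⊗ₜ[R] 1)
      = box (pmul X (S ⊗ₜ[R] 1)) (pmul Y (T ⊗ₜ[R] 1)) := by
  induction X with
  | zero => simp
  | add X X' h h' => simp only [map_add, LinearMap.add_apply, h, h']
  | tmul P a =>
    induction Y with
    | zero => simp
    | add Y Y' h h' => simp only [map_add, LinearMap.add_apply, h, h']
    | tmul Q b => simp only [box_tmul, pmul_tmul, TensorProduct.map_comp, mul_one]

theorem pmul_leg (S : H →ₗ[R] K) (T : H' →ₗ[R] K') (X : Module.End R H ⊗[R] B)
    (Y : Module.End R H' ⊗[R] B) (X' : Module.End R K ⊗[R] B) (Y' : Module.End R K' ⊗[R] B)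
    (hS : pmul (S ⊗ₜ[R] 1) X = pmul X' (S ⊗ₜ[R] 1))
    (hT : pmul (T ⊗ₜ[R] 1) Y = pmul Y' (T ⊗ₜ[R] 1)) :
    pmul (TensorProduct.map S T ⊗ₜ[R] 1) (leg13 R H H' X * leg23 R H H' Y)
      = pmul (leg13 R K K' X' * leg23 R K K' Y') (TensorProduct.map S T ⊗ₜ[R] 1) := by
  rw [leg_mul_leg, leg_mul_leg, pmul_box, box_pmul, hS, hT]

theorem assoc_leg (X : Module.End R H ⊗[R] B) (Y : Module.End R K ⊗[R] B)
    (Z : Module.End R L ⊗[R] B) :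
    pmul ((TensorProduct.assoc R H K L).toLinearMap ⊗ₜ[R] 1)
        (leg13 R (H ⊗[R] K) L (leg13 R H K X * leg23 R H K Y) * leg23 R (H ⊗[R] K) L Z)
      = pmul (leg13 R H (K ⊗[R] L) X * leg23 R H (K ⊗[R] L) (leg13 R K L Y * leg23 R K L Z))
        ((TensorProduct.assoc R H K L).toLinearMap ⊗ₜ[R] 1) := by
  simp only [leg_mul_leg]
  induction X with
  | zero => simp
  | add X X' h h' => simp only [map_add, LinearMap.add_apply, h, h']
  | tmul P a =>
    induction Y with
    | zero => simp
    | add Y Y' h h' => simp only [map_add, LinearMap.add_apply, h, h']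
    | tmul S b =>
      induction Z with
      | zero => simp
      | add Z Z' h h' => simp only [map_add, LinearMap.add_apply, h, h']
      | tmul T c =>
        simp only [box_tmul, pmul_tmul, one_mul, mul_one, mul_assoc]
        congr 1
        ext x y z
        rfl

theorem lunit_leg (X : Module.End R H ⊗[R] B) :
    pmul ((TensorProduct.lid R H).toLinearMap ⊗ₜ[R] 1) (leg13 R R H 1 * leg23 R R H X)
      = pmul X ((TensorProduct.lid R H).toLinearMap ⊗ₜ[R] 1) := by
  rw [map_one, one_mul]
  induction X with
  | zero => simp
  | add X X' h h' => simp only [map_add, LinearMap.add_apply, h, h']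
  | tmul P a =>
    simp only [leg23_tmul, pmul_tmul, one_mul, mul_one]
    congr 1
    ext x
    simp

theorem runit_leg (X : Module.End R H ⊗[R] B) :
    pmul ((TensorProduct.rid R H).toLinearMap ⊗ₜ[R] 1) (leg13 R H R X * leg23 R H R 1)
      = pmul X ((TensorProduct.rid R H).toLinearMap ⊗ₜ[R] 1) := by
  rw [map_one, mul_one]
  induction X with
  | zero => simp
  | add X X' h h' => simp only [map_add, LinearMap.add_apply, h, h']
  | tmul P a =>
    simp only [leg13_tmul, pmul_tmul, one_mul, mul_one]
    congr 1
    ext x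
    simp

theorem leg_comm (X : Module.End R H ⊗[R] B) (Y : Module.End R K ⊗[R] B) :
    leg13 R H K (Algebra.TensorProduct.map (AlgHom.id R (Module.End R H))
        (Algebra.TensorProduct.includeRight : B →ₐ[R] B ⊗[R] B) X)
      * leg23 R H K (Algebra.TensorProduct.map (AlgHom.id R (Module.End R K))
        (Algebra.TensorProduct.includeLeft : B →ₐ[R] B ⊗[R] B) Y)
    = leg23 R H K (Algebra.TensorProduct.map (AlgHom.id R (Module.End R K))
        (Algebra.TensorProduct.includeLeft : B →ₐ[R] B ⊗[R] B) Y)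
      * leg13 R H K (Algebra.TensorProduct.map (AlgHom.id R (Module.End R H))
        (Algebra.TensorProduct.includeRight : B →ₐ[R] B ⊗[R] B) X) := by
  induction X with
  | zero => simp
  | add X X' h h' => simp only [map_add, add_mul, mul_add, h, h']
  | tmul S a =>
    induction Y with
    | zero => simp
    | add Y Y' h h' => simp only [map_add, add_mul, mul_add, h, h']
    | tmul T b =>
      simp only [Algebra.TensorProduct.map_tmul, AlgHom.id_apply, leg13_tmul, leg23_tmul,
        Algebra.TensorProduct.tmul_mul_tmul, Algebra.TensorProduct.includeRight_apply,
        Algebra.TensorProduct.includeLeft_apply, one_mul, mul_one, Module.End.mul_eq_comp,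
        LinearMap.rTensor_comp_lTensor, LinearMap.lTensor_comp_rTensor]

theorem leg13_one : leg13 R H K (1 : Module.End R H ⊗[R] B) = 1 := map_one _

theorem leg23_one : leg23 R H K (1 : Module.End R K ⊗[R] B) = 1 := map_one _

theorem leg13_map (f : B →ₐ[R] C)
    (X : Module.End R H ⊗[R] B) :
    Algebra.TensorProduct.map (AlgHom.id R _) f (leg13 R H K X)
      = leg13 R H K (Algebra.TensorProduct.map (AlgHom.id R _) f X) := by
  induction X with
  | zero => simp
  | add X X' h h' => simp only [map_add, h, h']
  | tmul S a => rfl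

theorem leg23_map (f : B →ₐ[R] C)
    (X : Module.End R K ⊗[R] B) :
    Algebra.TensorProduct.map (AlgHom.id R _) f (leg23 R H K X)
      = leg23 R H K (Algebra.TensorProduct.map (AlgHom.id R _) f X) := by
  induction X with
  | zero => simp
  | add X X' h h' => simp only [map_add, h, h']
  | tmul S a => rfl

end Aux

section Star

variable {H K L : Type}
  [NormedAddCommGroup H] [InnerProductSpace ℂ H] [FiniteDimensional ℂ H]
  [NormedAddCommGroup K] [InnerProductSpace ℂ K] [FiniteDimensional ℂ K]
  [NormedAddCommGroup L] [InnerProductSpace ℂ L] [FiniteDimensional ℂ L]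

theorem star_leg13 (X : Module.End ℂ H ⊗[ℂ] O) : leg13 ℂ H K (star X) = star (leg13 ℂ H K X) := by
  induction X with
  | zero =>
    rw [star_zero, map_zero]
    exact (star_zero (Module.End ℂ (H ⊗[ℂ] K) ⊗[ℂ] O)).symm
  | add X X' h h' =>
    rw [star_add, map_add, map_add, h, h']
    exact (star_add (R := Module.End ℂ (H ⊗[ℂ] K) ⊗[ℂ] O) _ _).symm
  | tmul S a =>
    simp only [TensorProduct.star_tmul, leg13_tmul, LinearMap.star_eq_adjoint,
      LinearMap.adjoint_rTensor]

theorem star_leg23 (X : Module.End ℂ K ⊗[ℂ] O) : leg23 ℂ H K (star X) = star (leg23 ℂ H K X) := by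
  induction X with
  | zero =>
    rw [star_zero, map_zero]
    exact (star_zero (Module.End ℂ (H ⊗[ℂ] K) ⊗[ℂ] O)).symm
  | add X X' h h' =>
    rw [star_add, map_add, map_add, h, h']
    exact (star_add (R := Module.End ℂ (H ⊗[ℂ] K) ⊗[ℂ] O) _ _).symm
  | tmul S a =>
    simp only [TensorProduct.star_tmul, leg23_tmul, LinearMap.star_eq_adjoint,
      LinearMap.adjoint_lTensor]

/-- The conjugate linear map `T ⊗ a ↦ T* ⊗ a*`. -/
noncomputable def padj : (H →ₗ[ℂ] K) ⊗[ℂ] O →ₗ⋆[ℂ] (K →ₗ[ℂ] H) ⊗[ℂ] O :=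
  TensorProduct.map (LinearMap.adjoint (𝕜 := ℂ) (E := H) (F := K)).toLinearMap
    (starLinearEquiv ℂ (A := O)).toLinearMap

theorem padj_tmul (T : H →ₗ[ℂ] K) (a : O) :
    padj (T ⊗ₜ[ℂ] a) = LinearMap.adjoint T ⊗ₜ[ℂ] star a := rfl

theorem padj_eq_star (X : Module.End ℂ H ⊗[ℂ] O) : padj X = star X := by
  induction X with
  | zero => simp
  | add X X' h h' => simp only [map_add, star_add, h, h']
  | tmul S a => rfl

theorem padj_pmul (X : (K →ₗ[ℂ] L) ⊗[ℂ] O) (Y : (H →ₗ[ℂ] K) ⊗[ℂ] O) :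
    padj (pmul X Y) = pmul (padj Y) (padj X) := by
  induction X with
  | zero => simp
  | add X X' h h' => simp only [map_add, LinearMap.add_apply, h, h']
  | tmul S a =>
    induction Y with
    | zero => simp
    | add Y Y' h h' => simp only [map_add, LinearMap.add_apply, h, h']
    | tmul T b => simp only [pmul_tmul, padj_tmul, LinearMap.adjoint_comp, star_mul]

end Star

/-- The trivial representation on `ℂ`. -/
noncomputable def one (O : Type u) [Ring O] [StarRing O] [HopfAlgebra ℂ O] [StarModule ℂ O] :
    QRep O where
  H := ℂ
  U := 1
  unitary := one_mem _
  comul := by simp only [map_one, mul_one]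

/-- The tensor product `U × V = U₁₃ V₂₃` on `H_U ⊗ H_V`. -/
noncomputable def tensor (V W : QRep O) : QRep O where
  H := V.H ⊗[ℂ] W.H
  U := leg13 ℂ V.H W.H V.U * leg23 ℂ V.H W.H W.U
  unitary := by
    have h1 := V.unitary
    have h2 := W.unitary
    rw [Unitary.mem_iff] at h1 h2
    refine mul_mem ?_ ?_ <;> rw [Unitary.mem_iff]
    · simp only [← star_leg13, ← map_mul, h1, and_self]
      exact leg13_one
    · simp only [← star_leg23, ← map_mul, h2, and_self]
      exact leg23_one
  comul := by
    simp only [map_mul, leg13_map, leg23_map, V.comul, W.comul]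
    simp only [mul_assoc]
    congr 1
    simp only [← mul_assoc]
    rw [leg_comm]

/-- The space `Mor(V, W)` of intertwiners: operators `T` with `(T ⊗ 1) V = W (T ⊗ 1)`. -/
noncomputable def Mor (V W : QRep O) : Submodule ℂ (V.H →ₗ[ℂ] W.H) where
  carrier := {T | pmul (T ⊗ₜ[ℂ] (1 : O)) V.U = pmul W.U (T ⊗ₜ[ℂ] (1 : O))}
  zero_mem' := by simp
  add_mem' := by
    intro S T hS hT
    simp only [Set.mem_ofPred_eq] at hS hT ⊢
    simp only [TensorProduct.add_tmul, map_add, LinearMap.add_apply, hS, hT]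
  smul_mem' := by
    intro c T hT
    simp only [Set.mem_ofPred_eq] at hT ⊢
    simp only [← TensorProduct.smul_tmul', map_smul, LinearMap.smul_apply, hT]

namespace Mor

variable {V W X Y V' W' : QRep O}

/-- The identity morphism. -/
noncomputable def id (V : QRep O) : Mor V V :=
  ⟨LinearMap.id, (one_pmul V.U).trans (pmul_one V.U).symm⟩

/-- Composition of morphisms. -/
noncomputable def comp (S : Mor W X) (T : Mor V W) : Mor V X :=
  ⟨S.1 ∘ₗ T.1, by
    have hS : pmul (S.1 ⊗ₜ[ℂ] (1 : O)) W.U = pmul X.U (S.1 ⊗ₜ[ℂ] (1 : O)) := S.2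
    have hT : pmul (T.1 ⊗ₜ[ℂ] (1 : O)) V.U = pmul W.U (T.1 ⊗ₜ[ℂ] (1 : O)) := T.2
    have h : (S.1 ∘ₗ T.1) ⊗ₜ[ℂ] (1 : O) = pmul (S.1 ⊗ₜ[ℂ] (1 : O)) (T.1 ⊗ₜ[ℂ] (1 : O)) := by
      rw [pmul_tmul, mul_one]
    change pmul _ _ = pmul _ _
    rw [h, pmul_assoc, hT, ← pmul_assoc, hS, pmul_assoc]⟩

/-- The adjoint of a morphism. -/
noncomputable def adj (T : Mor V W) : Mor W V :=
  ⟨LinearMap.adjoint T.1, by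
    have hT : pmul (T.1 ⊗ₜ[ℂ] (1 : O)) V.U = pmul W.U (T.1 ⊗ₜ[ℂ] (1 : O)) := T.2
    have h := congrArg padj hT
    rw [padj_pmul, padj_pmul, padj_tmul, star_one, padj_eq_star, padj_eq_star] at h
    have h2 := congrArg (fun Z => pmul V.U (pmul Z W.U)) h
    simp only [pmul_assoc, pmul_eq_mul, Unitary.star_mul_self_of_mem W.unitary, pmul_one] at h2
    rw [← pmul_assoc V.U, pmul_eq_mul, Unitary.mul_star_self_of_mem V.unitary, one_pmul] at h2
    exact h2⟩

/-- The tensor product of morphisms. -/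
noncomputable def tensor (S : Mor V V') (T : Mor W W') : Mor (V.tensor W) (V'.tensor W') :=
  ⟨TensorProduct.map S.1 T.1, by
    have hS : pmul (S.1 ⊗ₜ[ℂ] (1 : O)) V.U = pmul V'.U (S.1 ⊗ₜ[ℂ] (1 : O)) := S.2
    have hT : pmul (T.1 ⊗ₜ[ℂ] (1 : O)) W.U = pmul W'.U (T.1 ⊗ₜ[ℂ] (1 : O)) := T.2
    exact pmul_leg S.1 T.1 V.U W.U V'.U W'.U hS hT⟩

/-- The associativity isomorphism `(V × W) × X → V × (W × X)`. -/
noncomputable def assoc (V W X : QRep O) :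
    Mor ((V.tensor W).tensor X) (V.tensor (W.tensor X)) :=
  ⟨(TensorProduct.assoc ℂ V.H W.H X.H).toLinearMap, assoc_leg V.U W.U X.U⟩

/-- The isomorphism `𝟙 × V → V`, `z ⊗ ξ ↦ z ξ`. -/
noncomputable def lunit (V : QRep O) : Mor ((one O).tensor V) V :=
  ⟨(TensorProduct.lid ℂ V.H).toLinearMap, lunit_leg V.U⟩

/-- The isomorphism `V × 𝟙 → V`, `ξ ⊗ z ↦ z ξ`. -/
noncomputable def runit (V : QRep O) : Mor (V.tensor (one O)) V :=
  ⟨(TensorProduct.rid ℂ V.H).toLinearMap, runit_leg V.U⟩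

/-- A morphism is unitary if `T*T = 1` and `TT* = 1`. -/
def IsUnitary (T : Mor V W) : Prop := comp (adj T) T = id V ∧ comp T (adj T) = id W

end Mor

end QRep
end Representations

/-! ## C*-correspondences -/

section Correspondences

universe v z z'

variable (A : Type v) [NonUnitalCStarAlgebra A] [PartialOrder A] [StarOrderedRing A]

/-- A C*-correspondence over `A`: a right Hilbert `A`-module with a nondegenerate left action of `A`
by adjointable operators. The norm is `‖x‖ = ‖⟨x, x⟩‖ ^ (1 / 2)`; completeness and density
are expressed through `‖⟨x, x⟩‖`. -/
structure Corr where
  /-- the underlying vector space -/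
  E : Type z
  [instGroup : AddCommGroup E]
  [instModule : Module ℂ E]
  /-- the right action, `ract x a = x a` -/
  ract : E →ₗ[ℂ] A →ₗ[ℂ] E
  /-- the left action, `lact a x = a x` -/
  lact : A →ₗ[ℂ] E →ₗ[ℂ] E
  /-- the `A`-valued inner product, conjugate linear in the first variable -/
  inner : E →ₗ⋆[ℂ] E →ₗ[ℂ] A
  ract_mul : ∀ x a b, ract x (a * b) = ract (ract x a) b
  inner_ract : ∀ x y a, inner x (ract y a) = inner x y * a
  star_inner : ∀ x y, star (inner x y) = inner y x
  inner_self_nonneg : ∀ x, 0 ≤ inner x x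
  inner_self_eq_zero : ∀ x, inner x x = 0 → x = 0
  complete : ∀ u : ℕ → E,
    (∀ ε > 0, ∃ N, ∀ m ≥ N, ∀ n ≥ N, ‖inner (u m - u n) (u m - u n)‖ < ε) →
    ∃ x, ∀ ε > 0, ∃ N, ∀ n ≥ N, ‖inner (u n - x) (u n - x)‖ < ε
  lact_mul : ∀ a b x, lact (a * b) x = lact a (lact b x)
  lact_ract : ∀ a x b, lact a (ract x b) = ract (lact a x) b
  inner_lact : ∀ a x y, inner (lact a x) y = inner x (lact (star a) y)
  nondegenerate : ∀ x, ∀ ε > 0, ∃ (n : ℕ) (a : Fin n → A) (y : Fin n → E),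
    ‖inner (x - ∑ i, lact (a i) (y i)) (x - ∑ i, lact (a i) (y i))‖ < ε

attribute [instance] Corr.instGroup Corr.instModule

variable {A}

namespace Corr

/-- `g` is an adjoint of `f`. -/
def IsAdjoint (M N : Corr A) (f : M.E → N.E) (g : N.E → M.E) : Prop :=
  ∀ x y, N.inner (f x) y = M.inner x (g y)

/-- The morphisms of `Hilb A`: adjointable `A`-bilinear maps. -/
def Mor (M N : Corr A) : Submodule ℂ (M.E →ₗ[ℂ] N.E) where
  carrier := {T | (∀ a x, T (M.lact a x) = N.lact a (T x)) ∧
    (∀ x a, T (M.ract x a) = N.ract (T x) a) ∧ ∃ g : N.E → M.E, IsAdjoint M N T g}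
  zero_mem' := ⟨by simp, by simp, fun _ => 0, fun x y => by simp⟩
  add_mem' := by
    rintro S T ⟨hS, hS', g, hg⟩ ⟨hT, hT', k, hk⟩
    refine ⟨fun a x => by simp [hS, hT], fun x a => by simp [hS', hT'], fun y => g y + k y,
      fun x y => ?_⟩
    simp [hg x y, hk x y]
  smul_mem' := by
    rintro c T ⟨hT, hT', k, hk⟩
    refine ⟨fun a x => by simp [hT], fun x a => by simp [hT'], fun y => (starRingEnd ℂ c) • k y,
      fun x y => ?_⟩
    simp [hk x y]

theorem norm_inner_add_le (P : Corr A) (x y : P.E) :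
    ‖P.inner (x + y) (x + y)‖ ≤ 2 * ‖P.inner x x‖ + 2 * ‖P.inner y y‖ := by
  have h : P.inner (x + y) (x + y) + P.inner (x - y) (x - y)
      = (2 : ℝ) • P.inner x x + (2 : ℝ) • P.inner y y := by
    simp only [map_add, map_sub, LinearMap.add_apply, LinearMap.sub_apply, two_smul]
    abel
  have h2 : P.inner (x + y) (x + y) ≤ (2 : ℝ) • P.inner x x + (2 : ℝ) • P.inner y y := by
    rw [← h]
    exact le_add_of_nonneg_right (P.inner_self_nonneg _)
  refine (CStarAlgebra.norm_le_norm_of_nonneg_of_le (P.inner_self_nonneg _) h2).trans ?_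
  refine (norm_add_le _ _).trans ?_
  simp [norm_smul]

/-- The space of bounded `A`-bilinear maps `M ⊗_A N → P`. The space `M ⊗_A N` is the completion of
the algebraic tensor product with respect to the seminorm
`‖∑ xᵢ ⊗ yᵢ‖² = ‖∑ ⟨yᵢ, ⟨xᵢ, xⱼ⟩ yⱼ⟩‖`, so such a map is the same as a bilinear map on `M × N` that is
bounded for this seminorm; `B x y` is the value of the map at `x ⊗ y`. -/
def BilinMap (M N P : Corr A) : Submodule ℂ (M.E →ₗ[ℂ] N.E →ₗ[ℂ] P.E) where
  carrier := {B | (∀ a x y, B (M.lact a x) y = P.lact a (B x y)) ∧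
    (∀ x y a, B x (N.ract y a) = P.ract (B x y) a) ∧
    (∀ x a y, B (M.ract x a) y = B x (N.lact a y)) ∧
    ∃ C : ℝ, ∀ (n : ℕ) (x : Fin n → M.E) (y : Fin n → N.E),
      ‖P.inner (∑ i, B (x i) (y i)) (∑ i, B (x i) (y i))‖
        ≤ C * ‖∑ i, ∑ j, N.inner (y i) (N.lact (M.inner (x i) (x j)) (y j))‖}
  zero_mem' := ⟨by simp, by simp, by simp, 0, by simp⟩
  add_mem' := by
    rintro S T ⟨h1, h2, h3, C, hC⟩ ⟨k1, k2, k3, D, hD⟩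
    refine ⟨fun a x y => by simp [h1, k1], fun x y a => by simp [h2, k2],
      fun x a y => by simp [h3, k3], 2 * C + 2 * D, fun n x y => ?_⟩
    simp only [LinearMap.add_apply, Finset.sum_add_distrib]
    refine (P.norm_inner_add_le _ _).trans ?_
    linarith [hC n x y, hD n x y]
  smul_mem' := by
    rintro c T ⟨k1, k2, k3, D, hD⟩
    refine ⟨fun a x y => by simp [k1], fun x y a => by simp [k2],
      fun x a y => by simp [k3], ‖c‖ * (‖c‖ * D), fun n x y => ?_⟩
    simp only [LinearMap.smul_apply, ← Finset.smul_sum, map_smul, LinearMap.map_smulₛₗ,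
      norm_smul, RCLike.norm_conj]
    have := mul_le_mul_of_nonneg_left (mul_le_mul_of_nonneg_left (hD n x y) (norm_nonneg c))
      (norm_nonneg c)
    simpa only [mul_assoc] using this

/-- `B` is (the restriction to elementary tensors of) an `A`-bilinear isometry `M ⊗_A N → P`, where
`⟨x ⊗ y, x' ⊗ y'⟩ = ⟨y, ⟨x, x'⟩ y'⟩`. -/
def IsIsometricBilin (M N P : Corr A) (B : M.E →ₗ[ℂ] N.E →ₗ[ℂ] P.E) : Prop :=
  (∀ a x y, B (M.lact a x) y = P.lact a (B x y)) ∧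
  (∀ x y a, B x (N.ract y a) = P.ract (B x y) a) ∧
  (∀ x a y, B (M.ract x a) y = B x (N.lact a y)) ∧
  ∀ x y x' y', P.inner (B x y) (B x' y') = N.inner y (N.lact (M.inner x x') y')

variable (A) in
/-- `A` as a correspondence over itself: `⟨x, y⟩ = x* y` and `A` acts by multiplication. -/
noncomputable def self : Corr.{v, v} A where
  E := A
  ract := LinearMap.mul ℂ A
  lact := LinearMap.mul ℂ A
  inner := (LinearMap.mul ℂ A).comp (starLinearEquiv ℂ (A := A)).toLinearMap
  ract_mul x a b := by simp [mul_assoc]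
  inner_ract x y a := by simp [mul_assoc]
  star_inner x y := by simp
  inner_self_nonneg x := by simp
  inner_self_eq_zero x h := by simpa using h
  complete u hu := by
    have hn : ∀ z : A, ‖star z * z‖ = ‖z‖ * ‖z‖ := fun z => CStarRing.norm_star_mul_self
    simp only [LinearMap.comp_apply, LinearEquiv.coe_coe, starLinearEquiv_apply,
      LinearMap.mul_apply', hn] at hu ⊢
    have hc : CauchySeq u := by
      rw [Metric.cauchySeq_iff]
      intro ε hε
      obtain ⟨N, hN⟩ := hu (ε * ε) (mul_pos hε hε)
      refine ⟨N, fun m hm n hn => ?_⟩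
      rw [dist_eq_norm]
      exact lt_of_mul_self_lt_mul_self₀ hε.le (hN m hm n hn)
    obtain ⟨x, hx⟩ := cauchySeq_tendsto_of_complete hc
    refine ⟨x, fun ε hε => ?_⟩
    obtain ⟨N, hN⟩ := Metric.tendsto_atTop.1 hx (√ε) (Real.sqrt_pos.2 hε)
    refine ⟨N, fun n hn => ?_⟩
    have h := hN n hn
    rw [dist_eq_norm] at h
    calc ‖u n - x‖ * ‖u n - x‖ < √ε * √ε := mul_self_lt_mul_self (norm_nonneg _) h
      _ = ε := Real.mul_self_sqrt hε.le
  lact_mul a b x := by simp [mul_assoc]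
  lact_ract a x b := by simp [mul_assoc]
  inner_lact a x y := by simp [mul_assoc]
  nondegenerate x ε hε := by
    have ht := (CStarAlgebra.increasingApproximateUnit A).tendsto_mul_right x
    obtain ⟨a, ha⟩ := (Metric.tendsto_nhds.1 ht (√ε) (Real.sqrt_pos.2 hε)).exists
    refine ⟨1, fun _ => a, fun _ => x, ?_⟩
    rw [dist_comm, dist_eq_norm] at ha
    have hn : ∀ z : A, ‖star z * z‖ = ‖z‖ * ‖z‖ := fun z => CStarRing.norm_star_mul_self
    simp only [LinearMap.comp_apply, LinearEquiv.coe_coe, starLinearEquiv_apply,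
      LinearMap.mul_apply', hn, Finset.univ_unique, Finset.sum_singleton]
    calc ‖x - a * x‖ * ‖x - a * x‖ < √ε * √ε := mul_self_lt_mul_self (norm_nonneg _) ha
      _ = ε := Real.mul_self_sqrt hε.le

/-- A unitary isomorphism of correspondences: a bijective `A`-bilinear map that preserves the inner
products. -/
structure UnitaryIso (M : Corr.{v, z} A) (N : Corr.{v, z'} A) where
  /-- the underlying linear bijection -/
  toEquiv : M.E ≃ₗ[ℂ] N.E
  map_lact : ∀ a x, toEquiv (M.lact a x) = N.lact a (toEquiv x)
  map_ract : ∀ x a, toEquiv (M.ract x a) = N.ract (toEquiv x) a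
  map_inner : ∀ x y, N.inner (toEquiv x) (toEquiv y) = M.inner x y

end Corr

end Correspondences

/-! ## Weak unitary tensor functors and systems of bilinear maps -/

/-- Composition of intertwiners. -/
infixr:80 " ⊚ " => QRep.Mor.comp

/-- Tensor product of intertwiners. -/
infixr:82 " ⊠ " => QRep.Mor.tensor

section WeakTensorFunctors

universe u v w z

/-- A weak unitary tensor functor `Rep G → Hilb A`. The identification of `F(𝟙)` with `A` is the
unitary isomorphism `unit`, and `mul V W x y` is the value of `F₂ : F(V) ⊗_A F(W) → F(V × W)` at
`x ⊗ y`. -/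
structure WeakUnitaryTensorFunctor (O : Type u) [Ring O] [StarRing O] [HopfAlgebra ℂ O]
    [StarModule ℂ O] (A : Type v) [NonUnitalCStarAlgebra A] [PartialOrder A]
    [StarOrderedRing A] where
  /-- the functor on objects -/
  obj : QRep O → Corr.{v, z} A
  /-- the functor on morphisms -/
  map : ∀ {V W : QRep O}, QRep.Mor V W →ₗ[ℂ] Corr.Mor (obj V) (obj W)
  map_id : ∀ (V : QRep O) (x : (obj V).E), (map (QRep.Mor.id V)).1 x = x
  map_comp : ∀ {V W X : QRep O} (S : QRep.Mor W X) (T : QRep.Mor V W) (x : (obj V).E),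
    (map (S ⊚ T)).1 x = (map S).1 ((map T).1 x)
  map_adj : ∀ {V W : QRep O} (T : QRep.Mor V W),
    Corr.IsAdjoint (obj V) (obj W) (map T).1 (map (QRep.Mor.adj T)).1
  /-- the identification of `A` with `F(𝟙)` -/
  unit : Corr.UnitaryIso (Corr.self A) (obj (QRep.one O))
  /-- the maps `F₂` -/
  mul : ∀ V W : QRep O, (obj V).E →ₗ[ℂ] (obj W).E →ₗ[ℂ] (obj (V.tensor W)).E
  mul_isometric : ∀ V W : QRep O,
    Corr.IsIsometricBilin (obj V) (obj W) (obj (V.tensor W)) (mul V W)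
  mul_natural : ∀ {V W V' W' : QRep O} (S : QRep.Mor V V') (T : QRep.Mor W W') (x : (obj V).E)
    (y : (obj W).E),
    (map (S ⊠ T)).1 (mul V W x y) = mul V' W' ((map S).1 x) ((map T).1 y)
  mul_unit_left : ∀ (V : QRep O) (a : A) (x : (obj V).E),
    (map (QRep.Mor.lunit V)).1 (mul (QRep.one O) V (unit.toEquiv a) x) = (obj V).lact a x
  mul_unit_right : ∀ (V : QRep O) (x : (obj V).E) (a : A),
    (map (QRep.Mor.runit V)).1 (mul V (QRep.one O) x (unit.toEquiv a)) = (obj V).ract x a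
  mul_assoc : ∀ (V W X : QRep O) (x : (obj V).E) (y : (obj W).E) (z : (obj X).E),
    (map (QRep.Mor.assoc V W X)).1 (mul (V.tensor W) X (mul V W x y) z)
      = mul V (W.tensor X) x (mul W X y z)
  adjointable : ∀ (V W : QRep O) (x : (obj V).E),
    ∃ g, Corr.IsAdjoint (obj W) (obj (V.tensor W)) (mul V W x) g
  adjoint_mul : ∀ (V W X : QRep O) (x : (obj V).E)
    (g : (obj (V.tensor W)).E → (obj W).E)
    (g' : (obj (V.tensor (W.tensor X))).E → (obj (W.tensor X)).E),
    Corr.IsAdjoint (obj W) (obj (V.tensor W)) (mul V W x) g →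
    Corr.IsAdjoint (obj (W.tensor X)) (obj (V.tensor (W.tensor X))) (mul V (W.tensor X) x) g' →
    ∀ (y : (obj (V.tensor W)).E) (z : (obj X).E),
      g' ((map (QRep.Mor.assoc V W X)).1 (mul (V.tensor W) X y z)) = mul W X (g y) z

variable {O : Type u} [Ring O] [StarRing O] [HopfAlgebra ℂ O] [StarModule ℂ O]
  {A : Type v} [NonUnitalCStarAlgebra A] [PartialOrder A] [StarOrderedRing A]

/-- A natural unitary monoidal isomorphism between weak unitary tensor functors. -/
structure MonoidalUnitaryIso (F F' : WeakUnitaryTensorFunctor.{u, v, z} O A) where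
  /-- the components -/
  app : ∀ V : QRep O, Corr.UnitaryIso (F.obj V) (F'.obj V)
  natural : ∀ {V W : QRep O} (T : QRep.Mor V W) (x : (F.obj V).E),
    (app W).toEquiv ((F.map T).1 x) = (F'.map T).1 ((app V).toEquiv x)
  map_mul : ∀ (V W : QRep O) (x : (F.obj V).E) (y : (F.obj W).E),
    (app (V.tensor W)).toEquiv (F.mul V W x y)
      = F'.mul V W ((app V).toEquiv x) ((app W).toEquiv y)
  map_unit : ∀ a : A, (app (QRep.one O)).toEquiv (F.unit.toEquiv a) = F'.unit.toEquiv a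

/-- A finite dimensional unitary representation is irreducible if it is nonzero and its only
endomorphisms are the scalars. -/
def QRep.IsIrreducible (V : QRep O) : Prop :=
  Nontrivial V.H ∧ ∀ T : QRep.Mor V V, ∃ c : ℂ, T = c • QRep.Mor.id V

/-- The family `(U_α)` contains exactly one representative of each class of irreducible unitary
representations up to unitary equivalence. -/
structure IsIrreducibleSystem {I : Type w} (U : I → QRep O) : Prop where
  irreducible : ∀ α, (U α).IsIrreducible
  exhaustive : ∀ V : QRep O, V.IsIrreducible → ∃ α, ∃ T : QRep.Mor V (U α), QRep.Mor.IsUnitary T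
  inequivalent : ∀ α β, (∃ T : QRep.Mor (U α) (U β), QRep.Mor.IsUnitary T) → α = β

/-- The maps `φ^γ_{α,β}` from `Mor(U_α × U_β, U_γ)` to the bounded `A`-bilinear maps
`M_α ⊗_A M_β → M_γ`. -/
abbrev BilinSystem {I : Type w} (U : I → QRep O) (M : I → Corr.{v, z} A) :=
  ∀ α β γ, QRep.Mor ((U α).tensor (U β)) (U γ) →ₗ[ℂ] Corr.BilinMap (M α) (M β) (M γ)

/-- The conditions on `(M_α)` and `(φ^γ_{α,β})`. Here `t : U_e → 𝟙` is the unitary that identifies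
`U_e` with the trivial representation, and `j : A → M_e` is the one that identifies `M_e` with `A`. -/
structure BilinSystem.IsCoherent {I : Type w} {U : I → QRep O} {M : I → Corr.{v, z} A}
    (φ : BilinSystem U M) (e : I) (t : QRep.Mor (U e) (QRep.one O))
    (j : Corr.UnitaryIso (Corr.self A) (M e)) : Prop where
  /-- if `(T_1, …, T_n) : U_α × U_β → ⊕ U_{γ_i}` is unitary, then
  `(φ(T_1), …, φ(T_n)) : M_α ⊗_A M_β → ⊕ M_{γ_i}` is isometric -/
  isometric : ∀ (α β : I) (n : ℕ) (γ : Fin n → I)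
    (T : ∀ i, QRep.Mor ((U α).tensor (U β)) (U (γ i))),
    ∑ i, QRep.Mor.adj (T i) ⊚ T i = QRep.Mor.id _ →
    (∀ i, T i ⊚ QRep.Mor.adj (T i) = QRep.Mor.id _) →
    (∀ i k, i ≠ k → T i ⊚ QRep.Mor.adj (T k) = 0) →
    ∀ (x x' : (M α).E) (y y' : (M β).E),
      ∑ i, (M (γ i)).inner ((φ α β (γ i) (T i)).1 x y) ((φ α β (γ i) (T i)).1 x' y')
        = (M β).inner y ((M β).lact ((M α).inner x x') y')
  unit_left : ∀ (β : I) (a : A) (x : (M β).E),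
    (φ e β β (QRep.Mor.lunit (U β) ⊚ (t ⊠ QRep.Mor.id (U β)))).1 (j.toEquiv a) x
      = (M β).lact a x
  unit_right : ∀ (α : I) (x : (M α).E) (a : A),
    (φ α e α (QRep.Mor.runit (U α) ⊚ (QRep.Mor.id (U α) ⊠ t))).1 x (j.toEquiv a)
      = (M α).ract x a
  assoc : ∀ (α β γ δ : I) (m n : ℕ) (κ : Fin m → I) (ν : Fin n → I)
    (T : ∀ i, QRep.Mor ((U α).tensor (U β)) (U (κ i)))
    (S : ∀ i, QRep.Mor ((U (κ i)).tensor (U γ)) (U δ))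
    (T' : ∀ k, QRep.Mor ((U β).tensor (U γ)) (U (ν k)))
    (S' : ∀ k, QRep.Mor ((U α).tensor (U (ν k))) (U δ)),
    ∑ i, S i ⊚ (T i ⊠ QRep.Mor.id (U γ))
      = ∑ k, S' k ⊚ (QRep.Mor.id (U α) ⊠ T' k) ⊚ QRep.Mor.assoc (U α) (U β) (U γ) →
    ∀ (x : (M α).E) (y : (M β).E) (z : (M γ).E),
      ∑ i, (φ (κ i) γ δ (S i)).1 ((φ α β (κ i) (T i)).1 x y) z
        = ∑ k, (φ α (ν k) δ (S' k)).1 x ((φ β γ (ν k) (T' k)).1 y z)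
  adjointable : ∀ (α β γ : I) (T : QRep.Mor ((U α).tensor (U β)) (U γ)) (x : (M α).E),
    ∃ g, Corr.IsAdjoint (M β) (M γ) ((φ α β γ T).1 x) g
  /-- the functions `g i` and `h k` are the adjoints `S_x[T_i]*` and `S_x[P_k]*` -/
  adjoint_mul : ∀ (α γ δ η : I) (m n : ℕ) (β : Fin m → I) (ν : Fin n → I)
    (T : ∀ i, QRep.Mor ((U α).tensor (U (β i))) (U γ))
    (S : ∀ i, QRep.Mor ((U (β i)).tensor (U δ)) (U η))
    (R : ∀ k, QRep.Mor ((U γ).tensor (U δ)) (U (ν k)))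
    (P : ∀ k, QRep.Mor ((U α).tensor (U η)) (U (ν k))),
    ∑ i, (QRep.Mor.id (U α) ⊠ S i) ⊚ QRep.Mor.assoc (U α) (U (β i)) (U δ)
        ⊚ (QRep.Mor.adj (T i) ⊠ QRep.Mor.id (U δ))
      = ∑ k, QRep.Mor.adj (P k) ⊚ R k →
    ∀ (x : (M α).E) (g : ∀ i, (M γ).E → (M (β i)).E) (h : ∀ k, (M (ν k)).E → (M η).E),
      (∀ i, Corr.IsAdjoint (M (β i)) (M γ) ((φ α (β i) γ (T i)).1 x) (g i)) →
      (∀ k, Corr.IsAdjoint (M η) (M (ν k)) ((φ α η (ν k) (P k)).1 x) (h k)) →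
      ∀ (y : (M γ).E) (z : (M δ).E),
        ∑ i, (φ (β i) δ η (S i)).1 (g i y) z = ∑ k, h k ((φ γ δ (ν k) (R k)).1 y z)

/-- `F` extends the system `φ` along the identifications `i α : F(U_α) → M_α`: one has
`F(T) F₂ = φ(T)` for all `T ∈ Mor(U_α × U_β, U_γ)`, and the identifications of `F(𝟙)`, `F(U_e)`,
`M_e` and `A` agree. -/
structure WeakUnitaryTensorFunctor.Extends {I : Type w} {U : I → QRep O} {M : I → Corr.{v, z} A}
    (F : WeakUnitaryTensorFunctor.{u, v, z} O A) (i : ∀ α, Corr.UnitaryIso (F.obj (U α)) (M α))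
    (φ : BilinSystem U M) (e : I) (t : QRep.Mor (U e) (QRep.one O))
    (j : Corr.UnitaryIso (Corr.self A) (M e)) : Prop where
  map_mul : ∀ (α β γ : I) (T : QRep.Mor ((U α).tensor (U β)) (U γ)) (x : (F.obj (U α)).E)
    (y : (F.obj (U β)).E),
    (i γ).toEquiv ((F.map T).1 (F.mul (U α) (U β) x y))
      = (φ α β γ T).1 ((i α).toEquiv x) ((i β).toEquiv y)
  unit : ∀ a : A, (i e).toEquiv ((F.map (QRep.Mor.adj t)).1 (F.unit.toEquiv a)) = j.toEquiv a

end WeakTensorFunctors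

/-! The category of finite dimensional unitary representations is semisimple. Each `V` has
isometries `emb k : U_{α_k} → V` with orthogonal ranges and `∑ emb k ∘ proj k = id`, where `proj k =
(emb k)*`, and by Schur's lemma the morphisms between the `U_α` are zero or scalars. A functor to
correspondences is therefore determined by its values on the `U_α`, and a tensor structure by the
maps `F(T)F₂` for `T : U_α × U_β → U_γ`. The proof turns this into a construction.

Existence. `F(V)` is the direct sum of the `M_{α_k}` along a chosen decomposition of `V`. A vector
`x` of `F(V)` is handled through its coordinates `F(S)x ∈ M_γ` for all `S : V → U_γ`. They depend
naturally on `S`, and a natural family is determined by its values at the chosen projections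
(`coord_of_natural`). Hence morphisms and `F₂` can be defined on the chosen projections, while
identities between them are checked at every `S`, where the choices no longer matter. The map `F₂`
is the one whose `S`-coordinate at `x ⊗ y` is `∑ φ(S(emb i ⊗ emb l))(x_i ⊗ y_l)`.

Each axiom then reduces to one of the hypotheses by inserting resolutions of the identity `∑ emb k ∘
proj k = id`. Isometry comes from (ii) through `sum_inner_ev`, the unit laws from (iii),
associativity from (iv) through `sum_ev_assoc`, and the adjoint condition from (v) through
`sum_evAdj_ev`.

Uniqueness. `F(V)` is spanned by the images of the maps `F(T)` with `T : U_α → V`. Any family of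
unitary isomorphisms `F(U_α) → F'(U_α)` is natural by Schur's lemma, so it extends to all `V` by
`F(T)x ↦ F'(T)θ(x)` (`extend_lin`). The extension is monoidal because `F(T)F₂` and `F'(T)F'₂` both
correspond to `φ(T)`. -/

set_option linter.unusedSectionVars false

/-! ### Calculus of intertwiners and Schur's lemma -/

section IntertwinerCalculus

universe u w

variable {O : Type u} [Ring O] [StarRing O] [HopfAlgebra ℂ O] [StarModule ℂ O]

namespace QRep.Mor

variable {V W X Y V' W' X' V'' W'' : QRep O}

theorem comp_assoc (R : Mor X Y) (S : Mor W X) (T : Mor V W) : (R ⊚ S) ⊚ T = R ⊚ S ⊚ T := rfl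

@[simp]
theorem id_comp (T : Mor V W) : id W ⊚ T = T := rfl

@[simp]
theorem comp_id (T : Mor V W) : T ⊚ id V = T := rfl

theorem comp_add (S : Mor W X) (T T' : Mor V W) : S ⊚ (T + T') = S ⊚ T + S ⊚ T' :=
  Subtype.ext (LinearMap.comp_add T.1 T'.1 S.1)

theorem add_comp (S S' : Mor W X) (T : Mor V W) : (S + S') ⊚ T = S ⊚ T + S' ⊚ T :=
  Subtype.ext (LinearMap.add_comp T.1 S'.1 S.1)

theorem comp_smul (S : Mor W X) (c : ℂ) (T : Mor V W) : S ⊚ (c • T) = c • S ⊚ T :=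
  Subtype.ext (LinearMap.comp_smul S.1 c T.1)

theorem smul_comp (S : Mor W X) (c : ℂ) (T : Mor V W) : (c • S) ⊚ T = c • S ⊚ T :=
  Subtype.ext (LinearMap.smul_comp c S.1 T.1)

@[simp]
theorem comp_zero (S : Mor W X) : S ⊚ (0 : Mor V W) = 0 := Subtype.ext (LinearMap.comp_zero S.1)

@[simp]
theorem zero_comp (T : Mor V W) : (0 : Mor W X) ⊚ T = 0 := Subtype.ext (LinearMap.zero_comp T.1)

theorem comp_sum {ι : Type*} (s : Finset ι) (S : Mor W X) (T : ι → Mor V W) :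
    S ⊚ ∑ i ∈ s, T i = ∑ i ∈ s, S ⊚ T i :=
  map_sum (AddMonoidHom.mk' (fun T : Mor V W => S ⊚ T) (comp_add S)) T s

theorem sum_comp {ι : Type*} (s : Finset ι) (S : ι → Mor W X) (T : Mor V W) :
    (∑ i ∈ s, S i) ⊚ T = ∑ i ∈ s, S i ⊚ T :=
  map_sum (AddMonoidHom.mk' (fun S : Mor W X => S ⊚ T) (fun S S' => add_comp S S' T)) S s

theorem add_tensor (S S' : Mor V V') (T : Mor W W') : (S + S') ⊠ T = S ⊠ T + S' ⊠ T :=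
  Subtype.ext (TensorProduct.map_add_left S.1 S'.1 T.1)

theorem tensor_add (S : Mor V V') (T T' : Mor W W') : S ⊠ (T + T') = S ⊠ T + S ⊠ T' :=
  Subtype.ext (TensorProduct.map_add_right S.1 T.1 T'.1)

theorem smul_tensor (c : ℂ) (S : Mor V V') (T : Mor W W') : (c • S) ⊠ T = c • (S ⊠ T) :=
  Subtype.ext (TensorProduct.map_smul_left c S.1 T.1)

theorem tensor_smul (S : Mor V V') (c : ℂ) (T : Mor W W') : S ⊠ (c • T) = c • (S ⊠ T) :=
  Subtype.ext (TensorProduct.map_smul_right c S.1 T.1)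

@[simp]
theorem zero_tensor (T : Mor W W') : (0 : Mor V V') ⊠ T = 0 :=
  Subtype.ext (TensorProduct.map_zero_left T.1)

@[simp]
theorem tensor_zero (S : Mor V V') : S ⊠ (0 : Mor W W') = 0 :=
  Subtype.ext (TensorProduct.map_zero_right S.1)

theorem sum_tensor {ι : Type*} (s : Finset ι) (S : ι → Mor V V') (T : Mor W W') :
    (∑ i ∈ s, S i) ⊠ T = ∑ i ∈ s, S i ⊠ T :=
  map_sum (AddMonoidHom.mk' (fun S : Mor V V' => S ⊠ T) (fun S S' => add_tensor S S' T)) S s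

theorem tensor_sum {ι : Type*} (s : Finset ι) (S : Mor V V') (T : ι → Mor W W') :
    S ⊠ (∑ i ∈ s, T i) = ∑ i ∈ s, S ⊠ T i :=
  map_sum (AddMonoidHom.mk' (fun T : Mor W W' => S ⊠ T) (tensor_add S)) T s

theorem tensor_comp (S' : Mor V' V'') (S : Mor V V') (T' : Mor W' W'') (T : Mor W W') :
    (S' ⊚ S) ⊠ (T' ⊚ T) = (S' ⊠ T') ⊚ (S ⊠ T) :=
  Subtype.ext (TensorProduct.map_comp S'.1 T'.1 S.1 T.1)

@[simp]
theorem id_tensor_id : id V ⊠ id W = id (V.tensor W) :=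
  Subtype.ext TensorProduct.map_id

@[simp]
theorem adj_id : adj (id V) = id V := Subtype.ext LinearMap.adjoint_id

theorem adj_comp (S : Mor W X) (T : Mor V W) : adj (S ⊚ T) = adj T ⊚ adj S :=
  Subtype.ext (LinearMap.adjoint_comp S.1 T.1)

@[simp]
theorem adj_adj (T : Mor V W) : adj (adj T) = T := Subtype.ext (LinearMap.adjoint_adjoint T.1)

theorem adj_add (S T : Mor V W) : adj (S + T) = adj S + adj T :=
  Subtype.ext (map_add LinearMap.adjoint S.1 T.1)

theorem adj_smul (c : ℂ) (T : Mor V W) : adj (c • T) = starRingEnd ℂ c • adj T :=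
  Subtype.ext (LinearMap.map_smulₛₗ LinearMap.adjoint.toLinearMap c T.1)

@[simp]
theorem adj_zero : adj (0 : Mor V W) = 0 := Subtype.ext (map_zero LinearMap.adjoint)

theorem adj_tensor (S : Mor V V') (T : Mor W W') : adj (S ⊠ T) = adj S ⊠ adj T :=
  Subtype.ext (TensorProduct.adjoint_map S.1 T.1)

theorem assoc_naturality (S : Mor V V') (T : Mor W W') (R : Mor X X') :
    assoc V' W' X' ⊚ ((S ⊠ T) ⊠ R) = (S ⊠ (T ⊠ R)) ⊚ assoc V W X :=
  Subtype.ext (TensorProduct.map_map_comp_assoc_eq S.1 T.1 R.1).symm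

theorem lunit_naturality (T : Mor V W) :
    lunit W ⊚ (id (one O) ⊠ T) = T ⊚ lunit V :=
  Subtype.ext (TensorProduct.ext' (M := ℂ) fun z x => (map_smul T.1 z x).symm)

theorem runit_naturality (T : Mor V W) :
    runit W ⊚ (T ⊠ id (one O)) = T ⊚ runit V :=
  Subtype.ext (TensorProduct.ext' (N := ℂ) fun x z => (map_smul T.1 z x).symm)

theorem ext_apply {S T : Mor V W} (h : ∀ x, S.1 x = T.1 x) : S = T :=
  Subtype.ext (LinearMap.ext h)

end QRep.Mor

namespace QRep

/-- A nonzero morphism between irreducible representations is a multiple of a unitary one. -/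
theorem exists_unitary_of_ne_zero {V W : QRep O} (hV : V.IsIrreducible) (hW : W.IsIrreducible)
    (T : Mor V W) (hT : T ≠ 0) : ∃ S : Mor V W, Mor.IsUnitary S := by
  obtain ⟨c, hc⟩ := hV.2 (Mor.adj T ⊚ T)
  obtain ⟨d, hd⟩ := hW.2 (T ⊚ Mor.adj T)
  -- Both scalars appear in `T T* T`, which equals `cT` and `dT`, and `T` is nonzero.
  have hcd : c = d := by
    have h : c • T = d • T := by
      rw [← Mor.comp_id T, ← Mor.comp_smul, ← hc, ← Mor.comp_assoc, hd, Mor.smul_comp]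
      rfl
    exact smul_left_injective ℂ hT h
  have hx : ∀ x : V.H, c * (inner ℂ x x : ℂ) = inner ℂ (T.1 x) (T.1 x) := fun x => by
    have h := congrArg (fun S : Mor V V => (inner ℂ x (S.1 x) : ℂ)) hc
    have h1 : (inner ℂ x ((Mor.adj T ⊚ T).1 x) : ℂ) = inner ℂ (T.1 x) (T.1 x) :=
      LinearMap.adjoint_inner_right T.1 x (T.1 x)
    have h2 : (inner ℂ x ((c • Mor.id V).1 x) : ℂ) = c * inner ℂ x x := inner_smul_right _ _ _
    rw [← h1, ← h2]
    exact h.symm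
  obtain ⟨x, hTx⟩ : ∃ x, T.1 x ≠ 0 := by
    by_contra! h
    exact hT (Mor.ext_apply h)
  have hx0 : x ≠ 0 := by
    rintro rfl
    simp at hTx
  have hcx := hx x
  rw [inner_self_eq_norm_sq_to_K, inner_self_eq_norm_sq_to_K] at hcx
  have hnx : (‖x‖ : ℝ) ≠ 0 := norm_ne_zero_iff.2 hx0
  have hnT : (‖T.1 x‖ : ℝ) ≠ 0 := norm_ne_zero_iff.2 hTx
  -- Since `c‖x‖² = ‖Tx‖²`, this positive `r` has `r² c = 1`, so that `rT` is unitary.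
  set r : ℝ := ‖x‖ / ‖T.1 x‖ with hr
  have hrc : ((r : ℂ) * r) * c = 1 := by
    have hnx' : ((‖x‖ : ℝ) : ℂ) ≠ 0 := Complex.ofReal_ne_zero.2 hnx
    have hnT' : ((‖T.1 x‖ : ℝ) : ℂ) ≠ 0 := Complex.ofReal_ne_zero.2 hnT
    have hc' : c * (‖x‖ : ℂ) ^ 2 = (‖T.1 x‖ : ℂ) ^ 2 := hcx
    rw [hr]
    push_cast
    field_simp
    linear_combination hc'
  refine ⟨(r : ℂ) • T, ?_, ?_⟩
  · rw [Mor.adj_smul, Mor.smul_comp, Mor.comp_smul, hc, Complex.conj_ofReal, smul_smul, smul_smul,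
      hrc, one_smul]
  · rw [Mor.adj_smul, Mor.smul_comp, Mor.comp_smul, hd, Complex.conj_ofReal, smul_smul, smul_smul,
      ← hcd, hrc, one_smul]

end QRep

variable {I : Type w} {U : I → QRep O}

/-- Schur's lemma as an induction principle: a morphism between members of an irreducible system is
zero or a scalar. -/
theorem IsIrreducibleSystem.schur (hU : IsIrreducibleSystem U)
    {motive : ∀ α β, QRep.Mor (U α) (U β) → Prop} (zero : ∀ α β, motive α β 0)
    (smul_id : ∀ α (c : ℂ), motive α α (c • QRep.Mor.id (U α))) {α β : I}
    (S : QRep.Mor (U α) (U β)) : motive α β S := by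
  by_cases hS : S = 0
  · rw [hS]
    exact zero α β
  · obtain rfl := hU.inequivalent α β
      (QRep.exists_unitary_of_ne_zero (hU.irreducible α) (hU.irreducible β) S hS)
    obtain ⟨c, rfl⟩ := (hU.irreducible α).2 S
    exact smul_id α c

end IntertwinerCalculus

/-! ### Subrepresentations, spectral projections and complete reducibility -/

section CompleteReducibility

universe u w

variable {O : Type u} [Ring O] [StarRing O] [HopfAlgebra ℂ O] [StarModule ℂ O]

namespace QRep

/-- Compression acts on the operator leg and `f` on the coefficient leg, so the two commute. With
`f` the comultiplication or one of the two embeddings of `O` into `O ⊗ O`, this carries the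
corepresentation identity over to a compression. -/
theorem map_pmul_pmul {R : Type*} [CommRing R] {H K : Type*} [AddCommGroup H] [Module R H]
    [AddCommGroup K] [Module R K] {B C : Type*} [Ring B] [Algebra R B] [Ring C] [Algebra R C]
    (f : B →ₐ[R] C) (S : H →ₗ[R] K) (T : K →ₗ[R] H) (X : Module.End R H ⊗[R] B) :
    Algebra.TensorProduct.map (AlgHom.id R (Module.End R K)) f
        (pmul (S ⊗ₜ[R] 1) (pmul X (T ⊗ₜ[R] 1)))
      = pmul (S ⊗ₜ[R] 1)
          (pmul (Algebra.TensorProduct.map (AlgHom.id R (Module.End R H)) f X) (T ⊗ₜ[R] 1)) := by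
  induction X with
  | zero => simp
  | add X X' h h' => simp only [map_add, LinearMap.add_apply, h, h']
  | tmul P a =>
    simp only [pmul_tmul, one_mul, mul_one, Algebra.TensorProduct.map_tmul, AlgHom.id_apply]

/-- Compression to a subspace is multiplicative when the projection commutes with one factor. -/
theorem pmul_pmul_mul {R : Type*} [CommRing R] {H K : Type*} [AddCommGroup H] [Module R H]
    [AddCommGroup K] [Module R K] {B : Type*} [Ring B] [Algebra R B] (s : K →ₗ[R] H)
    (s' : H →ₗ[R] K) (hs : s' ∘ₗ s = LinearMap.id) (X Y : Module.End R H ⊗[R] B)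
    (hY : pmul ((s ∘ₗ s') ⊗ₜ[R] (1 : B)) Y = pmul Y ((s ∘ₗ s') ⊗ₜ[R] (1 : B))) :
    pmul (s' ⊗ₜ[R] (1 : B)) (pmul (X * Y) (s ⊗ₜ[R] (1 : B)))
      = (pmul (s' ⊗ₜ[R] (1 : B)) (pmul X (s ⊗ₜ[R] (1 : B))) : Module.End R K ⊗[R] B)
        * pmul (s' ⊗ₜ[R] (1 : B)) (pmul Y (s ⊗ₜ[R] (1 : B))) := by
  have hab : pmul (s ⊗ₜ[R] (1 : B)) (s' ⊗ₜ[R] (1 : B)) = (s ∘ₗ s') ⊗ₜ[R] (1 : B) := by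
    rw [pmul_tmul, one_mul]
  have hPa : pmul ((s ∘ₗ s') ⊗ₜ[R] (1 : B)) (s ⊗ₜ[R] (1 : B)) = s ⊗ₜ[R] (1 : B) := by
    rw [pmul_tmul, one_mul, LinearMap.comp_assoc, hs, LinearMap.comp_id]
  rw [← pmul_eq_mul, ← pmul_eq_mul, pmul_assoc, pmul_assoc, pmul_assoc,
    ← pmul_assoc (s ⊗ₜ[R] (1 : B)), hab, ← pmul_assoc ((s ∘ₗ s') ⊗ₜ[R] (1 : B)), hY, pmul_assoc,
    hPa]

/-- The compression of a representation to a subspace whose projection is an intertwiner. -/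
theorem exists_sub_of_isometry (V : QRep O) {K : Type} [NormedAddCommGroup K]
    [InnerProductSpace ℂ K] [FiniteDimensional ℂ K] (s : K →ₗ[ℂ] V.H)
    (hs : LinearMap.adjoint s ∘ₗ s = LinearMap.id) (p : Mor V V)
    (hp : s ∘ₗ LinearMap.adjoint s = p.1) :
    ∃ (W : QRep O) (i : Mor W V), Mor.adj i ⊚ i = Mor.id W ∧ i ⊚ Mor.adj i = p := by
  have hPU : ∀ {q : Mor V V}, pmul (q.1 ⊗ₜ[ℂ] (1 : O)) V.U = pmul V.U (q.1 ⊗ₜ[ℂ] (1 : O)) :=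
    fun {q} => q.2
  have hpa : ∀ {L L' : Type} [NormedAddCommGroup L] [InnerProductSpace ℂ L]
      [FiniteDimensional ℂ L] [NormedAddCommGroup L'] [InnerProductSpace ℂ L']
      [FiniteDimensional ℂ L'] (r : L →ₗ[ℂ] L'), padj (r ⊗ₜ[ℂ] (1 : O))
        = LinearMap.adjoint r ⊗ₜ[ℂ] (1 : O) := fun r => by rw [padj_tmul, star_one]
  have hps : LinearMap.adjoint p.1 = p.1 := by
    rw [← hp, LinearMap.adjoint_comp, LinearMap.adjoint_adjoint]
  -- Compression is multiplicative only when the projection commutes with the right-hand factor. For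
  -- `U*U` that factor is `U`; for `UU*` it is `U*`, and for the comultiplication identity it is
  -- `U₁₃` (`hr` below).
  have hPU' : pmul (p.1 ⊗ₜ[ℂ] (1 : O)) (star V.U) = pmul (star V.U) (p.1 ⊗ₜ[ℂ] (1 : O)) := by
    have h := congrArg padj (hPU (q := p))
    rw [padj_pmul, padj_pmul, hpa, hps, padj_eq_star] at h
    exact h.symm
  have hstar : star (pmul (LinearMap.adjoint s ⊗ₜ[ℂ] (1 : O)) (pmul V.U (s ⊗ₜ[ℂ] (1 : O))) :
        Module.End ℂ K ⊗[ℂ] O)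
      = pmul (LinearMap.adjoint s ⊗ₜ[ℂ] (1 : O)) (pmul (star V.U) (s ⊗ₜ[ℂ] (1 : O))) := by
    rw [← padj_eq_star, padj_pmul, padj_pmul, hpa, hpa, LinearMap.adjoint_adjoint, padj_eq_star,
      pmul_assoc]
  have hone : pmul (LinearMap.adjoint s ⊗ₜ[ℂ] (1 : O))
      (pmul (1 : Module.End ℂ V.H ⊗[ℂ] O) (s ⊗ₜ[ℂ] (1 : O))) = (1 : Module.End ℂ K ⊗[ℂ] O) := by
    rw [one_pmul, pmul_tmul, hs, one_mul, Algebra.TensorProduct.one_def]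
    rfl
  have hr : pmul (p.1 ⊗ₜ[ℂ] (1 : O ⊗[ℂ] O)) (Algebra.TensorProduct.map (AlgHom.id ℂ _)
        (Algebra.TensorProduct.includeRight : O →ₐ[ℂ] O ⊗[ℂ] O) V.U)
      = pmul (Algebra.TensorProduct.map (AlgHom.id ℂ _)
        (Algebra.TensorProduct.includeRight : O →ₐ[ℂ] O ⊗[ℂ] O) V.U)
        (p.1 ⊗ₜ[ℂ] (1 : O ⊗[ℂ] O)) := by
    have h := congrArg (Algebra.TensorProduct.map (AlgHom.id ℂ (Module.End ℂ V.H))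
      (Algebra.TensorProduct.includeRight : O →ₐ[ℂ] O ⊗[ℂ] O)) (hPU (q := p))
    rw [pmul_eq_mul, pmul_eq_mul, map_mul, map_mul, Algebra.TensorProduct.map_tmul,
      map_one, AlgHom.id_apply] at h
    rw [pmul_eq_mul, pmul_eq_mul]
    exact h
  let W : QRep O :=
    { H := K
      U := pmul (LinearMap.adjoint s ⊗ₜ[ℂ] (1 : O)) (pmul V.U (s ⊗ₜ[ℂ] (1 : O)))
      unitary := by
        rw [Unitary.mem_iff, hstar]
        constructor
        · rw [← pmul_pmul_mul s _ hs _ _ (by rw [hp]; exact hPU),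
            Unitary.star_mul_self_of_mem V.unitary, hone]
        · rw [← pmul_pmul_mul s _ hs _ _ (by rw [hp]; exact hPU'),
            Unitary.mul_star_self_of_mem V.unitary, hone]
      comul := by
        rw [map_pmul_pmul, map_pmul_pmul, map_pmul_pmul, V.comul]
        exact pmul_pmul_mul s _ hs _ _ (by rw [hp]; exact hr) }
  let i : Mor W V := ⟨s, by
    change pmul (s ⊗ₜ[ℂ] (1 : O)) (pmul (LinearMap.adjoint s ⊗ₜ[ℂ] (1 : O))
      (pmul V.U (s ⊗ₜ[ℂ] (1 : O)))) = pmul V.U (s ⊗ₜ[ℂ] (1 : O))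
    rw [← pmul_assoc, pmul_tmul, hp, one_mul, ← pmul_assoc, hPU, pmul_assoc, pmul_tmul, ← hp,
      one_mul, LinearMap.comp_assoc, hs, LinearMap.comp_id]⟩
  exact ⟨W, i, Subtype.ext hs, Subtype.ext hp⟩

/-- A self-adjoint idempotent intertwiner is the range projection of a subrepresentation. -/
theorem exists_sub_of_projection (V : QRep O) (p : Mor V V) (hpp : p ⊚ p = p)
    (hps : Mor.adj p = p) :
    ∃ (W : QRep O) (i : Mor W V), Mor.adj i ⊚ i = Mor.id W ∧ i ⊚ Mor.adj i = p := by
  have hp1 : ∀ x, p.1 (p.1 x) = p.1 x := fun x => congrArg (fun q : Mor V V => q.1 x) hpp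
  have hp2 : ∀ x y : V.H, (inner ℂ (p.1 x) y : ℂ) = inner ℂ x (p.1 y) := fun x y => by
    conv_rhs => rw [← hps]
    exact (LinearMap.adjoint_inner_right p.1 x y).symm
  set s : LinearMap.range p.1 →ₗ[ℂ] V.H := (LinearMap.range p.1).subtype
  -- The adjoint of the inclusion of the range of `p` is `p` itself, corestricted to its range.
  have hadj : ∀ x, s (LinearMap.adjoint s x) = p.1 x := fun x => by
    have h : LinearMap.adjoint s x = ⟨p.1 x, x, rfl⟩ := by
      refine ext_inner_right ℂ fun y => ?_
      rw [LinearMap.adjoint_inner_left]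
      obtain ⟨_, z, rfl⟩ := y
      change (inner ℂ x (p.1 z) : ℂ) = inner ℂ (p.1 x) (p.1 z)
      rw [hp2, hp1]
    rw [h]
    rfl
  refine exists_sub_of_isometry V s (LinearMap.ext fun x => ?_) p (LinearMap.ext hadj)
  refine Subtype.ext ((hadj (s x)).trans ?_)
  obtain ⟨_, z, rfl⟩ := x
  exact hp1 z

/-- The endomorphisms of `V` form an algebra, so spectral projections obtained as polynomials in `S`
are again intertwiners. -/
theorem aeval_mem_mor (V : QRep O) (S : Mor V V) (f : Polynomial ℂ) :
    Polynomial.aeval (S.1 : Module.End ℂ V.H) f ∈ Mor V V := by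
  induction f using Polynomial.induction_on with
  | C a =>
    rw [Polynomial.aeval_C, Algebra.algebraMap_eq_smul_one]
    exact (Mor V V).smul_mem a (Mor.id V).2
  | add f g hf hg =>
    rw [map_add]
    exact (Mor V V).add_mem hf hg
  | monomial n a h =>
    rw [pow_succ, ← mul_assoc, map_mul, Polynomial.aeval_X]
    exact (Mor.comp ⟨_, h⟩ S).2

/-- A self-adjoint intertwiner that is not a scalar has a nontrivial spectral projection. -/
theorem exists_projection_of_selfAdjoint (V : QRep O) [Nontrivial V.H] (S : Mor V V)
    (hS : Mor.adj S = S) (hsc : ∀ c : ℂ, S ≠ c • Mor.id V) :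
    ∃ p : Mor V V, p ⊚ p = p ∧ Mor.adj p = p ∧ p ≠ 0 ∧ p ≠ Mor.id V := by
  obtain ⟨μ, hμ⟩ := Module.End.exists_eigenvalue (S.1 : Module.End ℂ V.H)
  obtain ⟨v, hv⟩ := hμ.exists_hasEigenvector
  have hsym : ∀ x y : V.H, (inner ℂ (S.1 x) y : ℂ) = inner ℂ x (S.1 y) := fun x y => by
    conv_rhs => rw [← hS]
    exact (LinearMap.adjoint_inner_right S.1 x y).symm
  have hμr : starRingEnd ℂ μ = μ := by
    have h1 := hsym v v
    rw [hv.apply_eq_smul, inner_smul_left, inner_smul_right] at h1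
    exact mul_right_cancel₀ (inner_self_ne_zero.2 hv.2) h1
  set R : Module.End ℂ V.H := S.1 - algebraMap ℂ (Module.End ℂ V.H) μ with hR
  have hRx : ∀ x, R x = S.1 x - μ • x := fun x => rfl
  have hRsym : ∀ x y : V.H, (inner ℂ (R x) y : ℂ) = inner ℂ x (R y) := fun x y => by
    rw [hRx, hRx, inner_sub_left, inner_sub_right, hsym, inner_smul_left, inner_smul_right, hμr]
  -- Self-adjointness of `R = S - μ` forces `ker R² = ker R`; this will make `μ` a simple root of
  -- the minimal polynomial.
  have hRR : ∀ x, R (R x) = 0 → R x = 0 := fun x hx => by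
    rw [← inner_self_eq_zero (𝕜 := ℂ), hRsym, hx, inner_zero_right]
  have hRaeval : Polynomial.aeval (S.1 : Module.End ℂ V.H) (Polynomial.X - Polynomial.C μ) = R := by
    rw [map_sub, Polynomial.aeval_X, Polynomial.aeval_C]
  have hint : IsIntegral ℂ (S.1 : Module.End ℂ V.H) := Algebra.IsIntegral.isIntegral _
  -- The minimal polynomial is `(X - μ) g`. The operator `q = g(S)` is nonzero by minimality and
  -- maps into `ker R`; it will turn out to be `g(μ)` times the projection onto the `μ`-eigenspace.
  obtain ⟨g, hg⟩ := Polynomial.dvd_iff_isRoot.2 (Module.End.isRoot_of_hasEigenvalue hμ)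
  have hmin := minpoly.aeval ℂ (S.1 : Module.End ℂ V.H)
  rw [hg, map_mul, hRaeval] at hmin
  set q : Module.End ℂ V.H := Polynomial.aeval (S.1 : Module.End ℂ V.H) g with hq
  have hRq : ∀ x, R (q x) = 0 := fun x => congrArg (fun T : Module.End ℂ V.H => T x) hmin
  have hg0 : g ≠ 0 := by
    rintro rfl
    exact minpoly.ne_zero hint (by rw [hg, mul_zero])
  have hq0 : q ≠ 0 := by
    intro h
    have hd := minpoly.dvd ℂ (S.1 : Module.End ℂ V.H) h
    have h1 := Polynomial.natDegree_le_of_dvd hd hg0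
    rw [hg, Polynomial.natDegree_mul (Polynomial.X_sub_C_ne_zero μ) hg0,
      Polynomial.natDegree_X_sub_C] at h1
    omega
  obtain ⟨k, hk⟩ : ∃ k : Polynomial ℂ, g - Polynomial.C (g.eval μ)
      = (Polynomial.X - Polynomial.C μ) * k :=
    Polynomial.dvd_iff_isRoot.2 (by simp [Polynomial.IsRoot])
  have hqk : ∀ x, q x = g.eval μ • x + R (Polynomial.aeval (S.1 : Module.End ℂ V.H) k x) := by
    intro x
    have h := congrArg (fun f => Polynomial.aeval (S.1 : Module.End ℂ V.H) f x) hk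
    simp only [map_sub, map_mul, Polynomial.aeval_C, Polynomial.aeval_X] at h
    rw [← sub_eq_iff_eq_add']
    exact h
  set c := g.eval μ with hc
  -- If `g(μ) = 0`, then `q = R k(S)` with `R q = 0`, and `ker R² = ker R` gives `q = 0`.
  have hc0 : c ≠ 0 := by
    intro h0
    refine hq0 (LinearMap.ext fun x => ?_)
    have h1 := hqk x
    rw [h0, zero_smul, zero_add] at h1
    rw [h1]
    exact hRR _ (by rw [← h1]; exact hRq x)
  have hqR : ∀ x, R x = 0 → q x = c • x := fun x hx => by
    have hcomm : R * Polynomial.aeval (S.1 : Module.End ℂ V.H) k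
        = Polynomial.aeval (S.1 : Module.End ℂ V.H) k * R := by
      rw [← hRaeval, ← map_mul, ← map_mul, mul_comm]
    have h := congrArg (fun T : Module.End ℂ V.H => T x) hcomm
    simp only [Module.End.mul_apply, hx, map_zero] at h
    rw [hqk, h, add_zero]
  let p : Mor V V := c⁻¹ • ⟨q, aeval_mem_mor V S g⟩
  have hpx : ∀ x, p.1 x = c⁻¹ • q x := fun x => rfl
  have hpR : ∀ x, R x = 0 → p.1 x = x := fun x hx => by
    rw [hpx, hqR x hx, inv_smul_smul₀ hc0]
  have hRp : ∀ x, R (p.1 x) = 0 := fun x => by rw [hpx, map_smul, hRq, smul_zero]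
  -- Here `px - x` lies in the range of `R`, which is orthogonal to `ker R` and so to every `py`.
  -- Hence `p*p = p*`, and taking adjoints gives `p = p*` and `p² = p` together.
  have hadj : Mor.adj p ⊚ p = Mor.adj p := by
    refine Mor.ext_apply fun x => ext_inner_right ℂ fun y => ?_
    change inner ℂ (LinearMap.adjoint p.1 (p.1 x)) y = (inner ℂ (LinearMap.adjoint p.1 x) y : ℂ)
    rw [LinearMap.adjoint_inner_left, LinearMap.adjoint_inner_left, hpx x, hqk, smul_add,
      inv_smul_smul₀ hc0, inner_add_left, ← map_smul, hRsym, hRp, inner_zero_right, add_zero]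
  have hself : Mor.adj p = p := by
    have h := congrArg Mor.adj hadj
    rw [Mor.adj_comp, Mor.adj_adj, hadj] at h
    exact h
  refine ⟨p, by rw [hself] at hadj; exact hadj, hself, fun h0 => ?_, fun h1 => ?_⟩
  · have hRv : R v = 0 := by rw [hRx, hv.apply_eq_smul, sub_self]
    have h := hpR v hRv
    rw [h0] at h
    exact hv.2 h.symm
  · refine hsc μ (Mor.ext_apply fun x => ?_)
    have h := hRp x
    rw [h1] at h
    exact sub_eq_zero.1 h

/-- Since `2T = (T + T*) - i(iT - iT*)`, one of the two self-adjoint intertwiners in brackets is not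
a scalar. -/
theorem exists_projection_of_not_scalar (V : QRep O) [Nontrivial V.H] (T : Mor V V)
    (hT : ∀ c : ℂ, T ≠ c • Mor.id V) :
    ∃ p : Mor V V, p ⊚ p = p ∧ Mor.adj p = p ∧ p ≠ 0 ∧ p ≠ Mor.id V := by
  by_cases h1 : ∀ c : ℂ, T + Mor.adj T ≠ c • Mor.id V
  · exact exists_projection_of_selfAdjoint V _
      (by rw [Mor.adj_add, Mor.adj_adj, add_comm]) h1
  by_cases h2 : ∀ c : ℂ, Complex.I • T + (-Complex.I) • Mor.adj T ≠ c • Mor.id V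
  · refine exists_projection_of_selfAdjoint V _ ?_ h2
    rw [Mor.adj_add, Mor.adj_smul, Mor.adj_smul, Mor.adj_adj, add_comm, map_neg, Complex.conj_I,
      neg_neg]
  push Not at h1 h2
  obtain ⟨c, hc⟩ := h1
  obtain ⟨d, hd⟩ := h2
  refine absurd ?_ (hT (2⁻¹ * (c - Complex.I * d)))
  rw [mul_smul, sub_smul, mul_smul, ← hc, ← hd, smul_add, smul_smul, smul_smul, mul_neg,
    Complex.I_mul_I, neg_neg, one_smul, neg_one_smul, add_sub_add_comm]
  simp only [sub_neg_eq_add, sub_self, add_zero]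
  rw [← two_smul ℂ T, smul_smul, inv_mul_cancel₀ two_ne_zero, one_smul]

end QRep

variable {I : Type w}

/-- A decomposition of a representation into an orthogonal direct sum of members of a family. -/
structure IrrepDecomposition (U : I → QRep O) (V : QRep O) (ι : Type) [Fintype ι] where
  /-- the index of the summand -/
  idx : ι → I
  /-- the isometric embedding of the summand -/
  emb : ∀ k, QRep.Mor (U (idx k)) V
  adj_emb_self : ∀ k, QRep.Mor.adj (emb k) ⊚ emb k = QRep.Mor.id _
  adj_emb_of_ne : ∀ k l, k ≠ l → QRep.Mor.adj (emb k) ⊚ emb l = 0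
  sum_emb : ∑ k, emb k ⊚ QRep.Mor.adj (emb k) = QRep.Mor.id V

variable {U : I → QRep O}

/-- An isometry between spaces of equal dimension is onto, and then `i i* = id`. This makes the
induction on the dimension terminate. -/
theorem QRep.finrank_lt_of_isometry {V W : QRep O} (i : QRep.Mor W V)
    (hi : QRep.Mor.adj i ⊚ i = QRep.Mor.id W) (hne : i ⊚ QRep.Mor.adj i ≠ QRep.Mor.id V) :
    Module.finrank ℂ W.H < Module.finrank ℂ V.H := by
  have hix : ∀ x, (QRep.Mor.adj i).1 (i.1 x) = x :=
    fun x => congrArg (fun q : QRep.Mor W W => q.1 x) hi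
  have hinj : Function.Injective i.1 := Function.LeftInverse.injective hix
  refine lt_of_le_of_ne (LinearMap.finrank_le_finrank_of_injective hinj) fun h => hne ?_
  refine QRep.Mor.ext_apply fun x => ?_
  obtain ⟨y, rfl⟩ := (LinearMap.injective_iff_surjective_of_finrank_eq_finrank h).1 hinj x
  exact congrArg i.1 (hix y)

/-- Complete reducibility. -/
theorem IsIrreducibleSystem.exists_decomposition (hU : IsIrreducibleSystem U) (n : ℕ) (V : QRep O)
    (hV : Module.finrank ℂ V.H = n) :
    ∃ (ι : Type) (_ : Fintype ι), Nonempty (IrrepDecomposition U V ι) := by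
  induction n using Nat.strong_induction_on generalizing V with
  | _ n ih =>
  rcases subsingleton_or_nontrivial V.H with hsub | hnt
  · refine ⟨Empty, inferInstance, ⟨⟨Empty.elim, fun k => k.elim, fun k => k.elim, fun k => k.elim,
      QRep.Mor.ext_apply fun x => Subsingleton.elim _ _⟩⟩⟩
  by_cases hirr : V.IsIrreducible
  · obtain ⟨α, T, hT, hT'⟩ := hU.exhaustive V hirr
    refine ⟨Unit, inferInstance, ⟨⟨fun _ => α, fun _ => QRep.Mor.adj T, fun _ => ?_,
      fun k l h => absurd rfl h, ?_⟩⟩⟩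
    · rw [QRep.Mor.adj_adj, hT']
    · rw [Fintype.sum_unique, QRep.Mor.adj_adj, hT]
  · obtain ⟨T, hT⟩ : ∃ T : QRep.Mor V V, ∀ c : ℂ, T ≠ c • QRep.Mor.id V := by
      by_contra! h
      exact hirr ⟨hnt, h⟩
    obtain ⟨p, hpp, hps, hp0, hp1⟩ := V.exists_projection_of_not_scalar T hT
    have hneg : ∀ q : QRep.Mor V V, (-1 : ℂ) • q = -q := fun q => neg_one_smul ℂ q
    -- The complementary projection. Both ranges are proper subrepresentations, so the induction
    -- hypothesis applies to each.
    set p' : QRep.Mor V V := QRep.Mor.id V + (-1 : ℂ) • p with hp'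
    have hp'p : p + p' = QRep.Mor.id V := by rw [hp', hneg]; abel
    have hpp' : p ⊚ p' = 0 := by
      rw [hp', QRep.Mor.comp_add, QRep.Mor.comp_smul, hpp, QRep.Mor.comp_id, hneg, add_neg_cancel]
    have hp'p' : p' ⊚ p' = p' := by
      have h := QRep.Mor.add_comp p p' p'
      rw [hp'p, hpp', zero_add] at h
      exact h.symm
    have hp's : QRep.Mor.adj p' = p' := by
      rw [hp', QRep.Mor.adj_add, QRep.Mor.adj_smul, QRep.Mor.adj_id, hps, map_neg, map_one]
    have hp'1 : p' ≠ QRep.Mor.id V := fun h => hp0 (by rw [← hpp', h, QRep.Mor.comp_id])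
    obtain ⟨W, i, hi, hi'⟩ := V.exists_sub_of_projection p hpp hps
    obtain ⟨W', i', hk, hk'⟩ := V.exists_sub_of_projection p' hp'p' hp's
    obtain ⟨ι, _, ⟨d⟩⟩ := ih _ (hV ▸ QRep.finrank_lt_of_isometry i hi (hi' ▸ hp1)) W rfl
    obtain ⟨ι', _, ⟨d'⟩⟩ := ih _ (hV ▸ QRep.finrank_lt_of_isometry i' hk (hk' ▸ hp'1)) W' rfl
    -- Inserting range projections, `i* i' = i* (i i*)(i' i'*) i' = i* (p p') i' = 0`.
    have hii' : QRep.Mor.adj i ⊚ i' = 0 := by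
      have h : QRep.Mor.adj i ⊚ (p ⊚ p') ⊚ i' = 0 := by
        rw [hpp', QRep.Mor.zero_comp, QRep.Mor.comp_zero]
      rw [← hi', ← hk'] at h
      simp only [QRep.Mor.comp_assoc, hk, QRep.Mor.comp_id] at h
      rwa [← QRep.Mor.comp_assoc, hi, QRep.Mor.id_comp] at h
    have hi'i : QRep.Mor.adj i' ⊚ i = 0 := by
      have h := congrArg QRep.Mor.adj hii'
      rwa [QRep.Mor.adj_comp, QRep.Mor.adj_adj, QRep.Mor.adj_zero] at h
    have hmid : ∀ {A B C D : QRep O} (a : QRep.Mor C V) (b : QRep.Mor A C) (a' : QRep.Mor D V)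
        (b' : QRep.Mor B D), QRep.Mor.adj (a ⊚ b) ⊚ a' ⊚ b'
          = QRep.Mor.adj b ⊚ (QRep.Mor.adj a ⊚ a') ⊚ b' :=
      fun a b a' b' => by rw [QRep.Mor.adj_comp]; rfl
    refine ⟨ι ⊕ ι', inferInstance, ⟨⟨Sum.elim d.idx d'.idx, fun k => match k with
      | .inl k => i ⊚ d.emb k
      | .inr k => i' ⊚ d'.emb k, ?_, ?_, ?_⟩⟩⟩
    · rintro (k | k)
      · refine (hmid i (d.emb k) i (d.emb k)).trans ?_
        rw [hi]
        exact d.adj_emb_self k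
      · refine (hmid i' (d'.emb k) i' (d'.emb k)).trans ?_
        rw [hk]
        exact d'.adj_emb_self k
    · rintro (k | k) (l | l) hkl
      · refine (hmid i (d.emb k) i (d.emb l)).trans ?_
        rw [hi]
        exact d.adj_emb_of_ne k l fun h => hkl (congrArg _ h)
      · refine (hmid i (d.emb k) i' (d'.emb l)).trans ?_
        rw [hii', QRep.Mor.zero_comp, QRep.Mor.comp_zero]
        rfl
      · refine (hmid i' (d'.emb k) i (d.emb l)).trans ?_
        rw [hi'i, QRep.Mor.zero_comp, QRep.Mor.comp_zero]
        rfl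
      · refine (hmid i' (d'.emb k) i' (d'.emb l)).trans ?_
        rw [hk]
        exact d'.adj_emb_of_ne k l fun h => hkl (congrArg _ h)
    · rw [Fintype.sum_sum_type]
      have h1 : ∑ k, (i ⊚ d.emb k) ⊚ QRep.Mor.adj (i ⊚ d.emb k) = p := by
        have h : ∀ k, (i ⊚ d.emb k) ⊚ QRep.Mor.adj (i ⊚ d.emb k)
            = i ⊚ (d.emb k ⊚ QRep.Mor.adj (d.emb k)) ⊚ QRep.Mor.adj i := fun k => by
          rw [QRep.Mor.adj_comp]; rfl
        simp only [h]
        rw [← QRep.Mor.comp_sum, ← QRep.Mor.sum_comp, d.sum_emb, QRep.Mor.id_comp, hi']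
      have h2 : ∑ k, (i' ⊚ d'.emb k) ⊚ QRep.Mor.adj (i' ⊚ d'.emb k) = p' := by
        have h : ∀ k, (i' ⊚ d'.emb k) ⊚ QRep.Mor.adj (i' ⊚ d'.emb k)
            = i' ⊚ (d'.emb k ⊚ QRep.Mor.adj (d'.emb k)) ⊚ QRep.Mor.adj i' := fun k => by
          rw [QRep.Mor.adj_comp]; rfl
        simp only [h]
        rw [← QRep.Mor.comp_sum, ← QRep.Mor.sum_comp, d'.sum_emb, QRep.Mor.id_comp, hk']
      exact (congrArg₂ (· + ·) h1 h2).trans hp'p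

theorem IsIrreducibleSystem.exists_decomposition_fin (hU : IsIrreducibleSystem U) (V : QRep O) :
    ∃ n : ℕ, Nonempty (IrrepDecomposition U V (Fin n)) := by
  obtain ⟨ι, _, ⟨d⟩⟩ := hU.exists_decomposition _ V rfl
  let f := (Fintype.equivFin ι).symm
  refine ⟨Fintype.card ι, ⟨⟨fun k => d.idx (f k), fun k => d.emb (f k),
    fun k => d.adj_emb_self _, fun k l h => d.adj_emb_of_ne _ _ (f.injective.ne h), ?_⟩⟩⟩
  exact (f.sum_comp fun k => d.emb k ⊚ QRep.Mor.adj (d.emb k)).trans d.sum_emb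

end CompleteReducibility

/-! ### Hilbert module preliminaries and finite direct sums of correspondences -/

section DirectSums

universe v z z' z''

variable {A : Type v} [NonUnitalCStarAlgebra A] [PartialOrder A] [StarOrderedRing A]

namespace Corr

theorem ext_inner (N : Corr.{v, z} A) {x y : N.E} (h : ∀ w, N.inner w x = N.inner w y) : x = y := by
  refine sub_eq_zero.1 (N.inner_self_eq_zero _ ?_)
  rw [map_sub, h, sub_self]

/-- The inner product is nondegenerate. The axioms about adjoints quantify over arbitrary functions
adjoint to a given map, and this allows a particular one to be substituted. -/
theorem IsAdjoint.unique {M : Corr.{v, z} A} {N : Corr.{v, z'} A} {f : M.E → N.E}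
    {g g' : N.E → M.E} (h : ∀ x y, N.inner (f x) y = M.inner x (g y))
    (h' : ∀ x y, N.inner (f x) y = M.inner x (g' y)) : g = g' :=
  funext fun y => M.ext_inner fun x => (h x y).symm.trans (h' x y)

/-- The inverse of a unitary isomorphism. -/
def UnitaryIso.symm {M : Corr.{v, z} A} {N : Corr.{v, z'} A} (f : UnitaryIso M N) :
    UnitaryIso N M where
  toEquiv := f.toEquiv.symm
  map_lact a x := by
    rw [LinearEquiv.symm_apply_eq, f.map_lact, LinearEquiv.apply_symm_apply]
  map_ract x a := by
    rw [LinearEquiv.symm_apply_eq, f.map_ract, LinearEquiv.apply_symm_apply]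
  map_inner x y := by
    rw [← f.map_inner, LinearEquiv.apply_symm_apply, LinearEquiv.apply_symm_apply]

/-- The composition of unitary isomorphisms. -/
def UnitaryIso.trans {M : Corr.{v, z} A} {N : Corr.{v, z'} A} {P : Corr.{v, z''} A}
    (f : UnitaryIso M N) (g : UnitaryIso N P) : UnitaryIso M P where
  toEquiv := f.toEquiv.trans g.toEquiv
  map_lact a x := by
    rw [LinearEquiv.trans_apply, f.map_lact, g.map_lact, LinearEquiv.trans_apply]
  map_ract x a := by
    rw [LinearEquiv.trans_apply, f.map_ract, g.map_ract, LinearEquiv.trans_apply]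
  map_inner x y := by
    rw [LinearEquiv.trans_apply, LinearEquiv.trans_apply, g.map_inner, f.map_inner]

/-- All summands are positive and the norm is monotone on positive elements. Cauchy sequences in a
direct sum are thus Cauchy in each coordinate. -/
theorem norm_inner_le_norm_sum {n : ℕ} (N : Fin n → Corr.{v, z} A) (x : ∀ i, (N i).E) (k : Fin n) :
    ‖(N k).inner (x k) (x k)‖ ≤ ‖∑ i, (N i).inner (x i) (x i)‖ :=
  CStarAlgebra.norm_le_norm_of_nonneg_of_le ((N k).inner_self_nonneg _)
    (Finset.single_le_sum (f := fun i => (N i).inner (x i) (x i))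
      (fun i _ => (N i).inner_self_nonneg _) (Finset.mem_univ k))

/-- Dividing by `n + 1` rather than `n` covers the empty sum and keeps the inequality strict. -/
theorem norm_sum_lt_of_forall {n : ℕ} {a : Fin n → A} {ε : ℝ} (hε : 0 < ε)
    (h : ∀ i, ‖a i‖ < ε / (n + 1)) : ‖∑ i, a i‖ < ε := by
  have hn : (0 : ℝ) < n + 1 := by positivity
  calc ‖∑ i, a i‖ ≤ ∑ i, ‖a i‖ := norm_sum_le _ _
    _ ≤ ∑ _i : Fin n, ε / (n + 1) := Finset.sum_le_sum fun i _ => (h i).le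
    _ = n * (ε / (n + 1)) := by simp
    _ < (n + 1) * (ε / (n + 1)) := by
      have := div_pos hε hn
      linarith
    _ = ε := mul_div_cancel₀ ε hn.ne'

/-- The direct sum of finitely many correspondences. -/
noncomputable def pi {n : ℕ} (N : Fin n → Corr.{v, z} A) : Corr.{v, z} A where
  E := ∀ i, (N i).E
  ract := LinearMap.mk₂ ℂ (fun x a i => (N i).ract (x i) a)
    (fun x y a => funext fun i => by simp) (fun c x a => funext fun i => by simp)
    (fun x a b => funext fun i => by simp) (fun c x a => funext fun i => by simp)
  lact := LinearMap.mk₂ ℂ (fun a x i => (N i).lact a (x i))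
    (fun x y a => funext fun i => by simp) (fun c x a => funext fun i => by simp)
    (fun x a b => funext fun i => by simp) (fun c x a => funext fun i => by simp)
  inner := LinearMap.mk₂'ₛₗ (starRingEnd ℂ) (RingHom.id ℂ)
    (fun x y => ∑ i, (N i).inner (x i) (y i))
    (fun x y a => by simp [Finset.sum_add_distrib])
    (fun c x a => by simp [Finset.smul_sum])
    (fun x a b => by simp [Finset.sum_add_distrib])
    (fun c x a => by simp [Finset.smul_sum])
  ract_mul x a b := funext fun i => (N i).ract_mul _ _ _
  inner_ract x y a := by
    simp only [LinearMap.mk₂_apply, LinearMap.mk₂'ₛₗ_apply, (N _).inner_ract, Finset.sum_mul]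
  star_inner x y := by
    simp only [LinearMap.mk₂'ₛₗ_apply, star_sum, (N _).star_inner]
  inner_self_nonneg x := by
    simp only [LinearMap.mk₂'ₛₗ_apply]
    exact Finset.sum_nonneg fun i _ => (N i).inner_self_nonneg _
  inner_self_eq_zero x h := by
    simp only [LinearMap.mk₂'ₛₗ_apply] at h
    exact funext fun i => (N i).inner_self_eq_zero _ <|
      (Finset.sum_eq_zero_iff_of_nonneg fun i _ => (N i).inner_self_nonneg _).1 h i
        (Finset.mem_univ i)
  complete u hu := by
    simp only [LinearMap.mk₂'ₛₗ_apply] at hu ⊢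
    have hi : ∀ i, ∃ x, ∀ ε > 0, ∃ K, ∀ k ≥ K,
        ‖(N i).inner (u k i - x) (u k i - x)‖ < ε := fun i => by
      refine (N i).complete (fun k => u k i) fun ε hε => ?_
      obtain ⟨K, hK⟩ := hu ε hε
      exact ⟨K, fun m hm k hk => (norm_inner_le_norm_sum N (u m - u k) i).trans_lt (hK m hm k hk)⟩
    choose x hx using hi
    refine ⟨x, fun ε hε => ?_⟩
    have hn : (0 : ℝ) < n + 1 := by positivity
    choose K hK using fun i => hx i (ε / (n + 1)) (div_pos hε hn)
    refine ⟨Finset.univ.sup K, fun k hk => norm_sum_lt_of_forall hε fun i => ?_⟩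
    exact hK i k ((Finset.le_sup (Finset.mem_univ i)).trans hk)
  lact_mul a b x := funext fun i => (N i).lact_mul _ _ _
  lact_ract a x b := funext fun i => (N i).lact_ract _ _ _
  inner_lact a x y := by
    simp only [LinearMap.mk₂_apply, LinearMap.mk₂'ₛₗ_apply, (N _).inner_lact]
  nondegenerate x ε hε := by
    classical
    simp only [LinearMap.mk₂_apply, LinearMap.mk₂'ₛₗ_apply]
    have hn : (0 : ℝ) < n + 1 := by positivity
    choose m a y hy using fun i => (N i).nondegenerate (x i) (ε / (n + 1)) (div_pos hε hn)
    -- The approximations of the separate coordinates are listed as one family, each vector being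
    -- supported in its own coordinate.
    let f := (Fintype.equivFin (Σ i, Fin (m i))).symm
    refine ⟨Fintype.card (Σ i, Fin (m i)), fun k => a (f k).1 (f k).2,
      fun k => Pi.single (f k).1 (y (f k).1 (f k).2), norm_sum_lt_of_forall hε fun i => ?_⟩
    have key : (∑ k, fun i => (N i).lact (a (f k).1 (f k).2)
        ((Pi.single (f k).1 (y (f k).1 (f k).2) : ∀ i, (N i).E) i)) i
          = ∑ k, (N i).lact (a i k) (y i k) := by
      rw [Finset.sum_apply, f.sum_comp fun p => (N i).lact (a p.1 p.2)
        ((Pi.single p.1 (y p.1 p.2) : ∀ i, (N i).E) i), Fintype.sum_sigma,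
        Finset.sum_eq_single i]
      · simp
      · intro l _ hl
        simp [Pi.single_eq_of_ne hl.symm]
      · simp
    rw [Pi.sub_apply, key]
    exact hy i

end Corr

end DirectSums

/-! ### Naturality of `M` and `φ` on irreducible representations -/

section IrreducibleCalculus

universe u v w z

variable {O : Type u} [Ring O] [StarRing O] [HopfAlgebra ℂ O] [StarModule ℂ O]
  {A : Type v} [NonUnitalCStarAlgebra A] [PartialOrder A] [StarOrderedRing A]
  {I : Type w} {U : I → QRep O}

/-- The normalized trace of an endomorphism. -/
noncomputable def QRep.Mor.normTrace (V : QRep O) : QRep.Mor V V →ₗ[ℂ] ℂ :=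
  (Module.finrank ℂ V.H : ℂ)⁻¹ • (LinearMap.trace ℂ V.H ∘ₗ (QRep.Mor V V).subtype)

theorem QRep.IsIrreducible.normTrace_id {V : QRep O} (hV : V.IsIrreducible) :
    QRep.Mor.normTrace V (QRep.Mor.id V) = 1 := by
  have := hV.1
  have h : (Module.finrank ℂ V.H : ℂ) ≠ 0 := Nat.cast_ne_zero.2 Module.finrank_pos.ne'
  change (Module.finrank ℂ V.H : ℂ)⁻¹ * LinearMap.trace ℂ V.H LinearMap.id = 1
  rw [LinearMap.trace_id, inv_mul_cancel₀ h]

open Classical in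
/-- The map `M_α → M_β` induced by a morphism `U_α → U_β` of irreducible representations: the
scalar by which it acts if `α = β`, and zero otherwise. -/
noncomputable def irrMap (M : I → Corr.{v, z} A) {α β : I} :
    QRep.Mor (U α) (U β) →ₗ[ℂ] (M α).E →ₗ[ℂ] (M β).E :=
  if h : α = β then by
    subst h
    -- The normalized trace is linear by construction and reads off `c` from `c · id`.
    exact (QRep.Mor.normTrace (U α)).smulRight LinearMap.id
  else 0

variable {M : I → Corr.{v, z} A} (hU : IsIrreducibleSystem U)

include hU

/-- An irreducible representation is nonzero, so the normalized trace of its identity is 1. By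
linearity and Schur's lemma this single value controls all morphisms in the lemmas that follow. -/
theorem irrMap_id (α : I) (x : (M α).E) : irrMap M (QRep.Mor.id (U α)) x = x := by
  rw [irrMap, dif_pos rfl]
  change QRep.Mor.normTrace (U α) (QRep.Mor.id (U α)) • x = x
  rw [(hU.irreducible α).normTrace_id, one_smul]

theorem irrMap_comp {α β γ : I} (S : QRep.Mor (U β) (U γ)) (T : QRep.Mor (U α) (U β))
    (x : (M α).E) : irrMap M (S ⊚ T) x = irrMap M S (irrMap M T x) :=
  hU.schur (motive := fun α β T => ∀ (S : QRep.Mor (U β) (U γ)) (x : (M α).E),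
      irrMap M (S ⊚ T) x = irrMap M S (irrMap M T x))
    (fun α β S x => by simp) (fun α c S x => by
      rw [QRep.Mor.comp_smul, QRep.Mor.comp_id, map_smul, map_smul, LinearMap.smul_apply,
        LinearMap.smul_apply, irrMap_id hU, map_smul]) T S x

theorem inner_irrMap {α β : I} (T : QRep.Mor (U α) (U β)) (x : (M α).E) (y : (M β).E) :
    (M β).inner (irrMap M T x) y = (M α).inner x (irrMap M (QRep.Mor.adj T) y) :=
  hU.schur (motive := fun α β T => ∀ (x : (M α).E) (y : (M β).E),
      (M β).inner (irrMap M T x) y = (M α).inner x (irrMap M (QRep.Mor.adj T) y))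
    (fun α β x y => by simp) (fun α c x y => by
      rw [QRep.Mor.adj_smul, QRep.Mor.adj_id, map_smul, map_smul, LinearMap.smul_apply,
        LinearMap.smul_apply, irrMap_id hU, irrMap_id hU, LinearMap.map_smulₛₗ,
        LinearMap.map_smulₛₗ, LinearMap.smul_apply, RingHom.id_apply]) T x y

theorem irrMap_lact {α β : I} (T : QRep.Mor (U α) (U β)) (a : A) (x : (M α).E) :
    irrMap M T ((M α).lact a x) = (M β).lact a (irrMap M T x) :=
  hU.schur (motive := fun α β T => ∀ (x : (M α).E),
      irrMap M T ((M α).lact a x) = (M β).lact a (irrMap M T x))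
    (fun α β x => by simp) (fun α c x => by
      rw [map_smul, LinearMap.smul_apply, LinearMap.smul_apply, irrMap_id hU, irrMap_id hU,
        map_smul]) T x

theorem irrMap_ract {α β : I} (T : QRep.Mor (U α) (U β)) (x : (M α).E) (a : A) :
    irrMap M T ((M α).ract x a) = (M β).ract (irrMap M T x) a :=
  hU.schur (motive := fun α β T => ∀ (x : (M α).E),
      irrMap M T ((M α).ract x a) = (M β).ract (irrMap M T x) a)
    (fun α β x => by simp) (fun α c x => by
      rw [map_smul, LinearMap.smul_apply, LinearMap.smul_apply, irrMap_id hU, irrMap_id hU,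
        map_smul, LinearMap.smul_apply]) T x

omit hU in
/-- The map `T ↦ φ(T)` with values in bilinear maps. -/
noncomputable def BilinSystem.ev (φ : BilinSystem U M) {α β γ : I} :
    QRep.Mor ((U α).tensor (U β)) (U γ) →ₗ[ℂ] (M α).E →ₗ[ℂ] (M β).E →ₗ[ℂ] (M γ).E :=
  (Corr.BilinMap (M α) (M β) (M γ)).subtype ∘ₗ φ α β γ

variable (φ : BilinSystem U M)

/-- Naturality of `φ` in its target, and likewise in its two source variables below, needs no
hypothesis beyond linearity: by Schur's lemma `R` is zero or a scalar. -/
theorem BilinSystem.ev_comp {α β γ δ : I} (R : QRep.Mor (U γ) (U δ))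
    (T : QRep.Mor ((U α).tensor (U β)) (U γ)) (x : (M α).E) (y : (M β).E) :
    φ.ev (R ⊚ T) x y = irrMap M R (φ.ev T x y) :=
  hU.schur (motive := fun γ δ R => ∀ T : QRep.Mor ((U α).tensor (U β)) (U γ),
      φ.ev (R ⊚ T) x y = irrMap M R (φ.ev T x y))
    (fun γ δ T => by simp) (fun γ c T => by
      rw [QRep.Mor.smul_comp, QRep.Mor.id_comp, map_smul, map_smul, LinearMap.smul_apply,
        LinearMap.smul_apply, LinearMap.smul_apply, irrMap_id hU]) R T

theorem BilinSystem.ev_tensor_id {α α' β γ : I} (S : QRep.Mor (U α) (U α')) {W : QRep O}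
    (X : QRep.Mor (U β) W)
    (T : QRep.Mor ((U α').tensor W) (U γ)) (x : (M α).E) (y : (M β).E) :
    φ.ev (T ⊚ (S ⊠ X)) x y = φ.ev (T ⊚ (QRep.Mor.id _ ⊠ X)) (irrMap M S x) y :=
  hU.schur (motive := fun α α' S => ∀ (T : QRep.Mor ((U α').tensor W) (U γ)) (x : (M α).E),
      φ.ev (T ⊚ (S ⊠ X)) x y = φ.ev (T ⊚ (QRep.Mor.id _ ⊠ X)) (irrMap M S x) y)
    (fun α α' T x => by simp) (fun α c T x => by
      rw [QRep.Mor.smul_tensor, QRep.Mor.comp_smul, map_smul, map_smul, LinearMap.smul_apply,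
        LinearMap.smul_apply, LinearMap.smul_apply, irrMap_id hU, map_smul,
        LinearMap.smul_apply]) S T x

theorem BilinSystem.ev_id_tensor {α β β' γ : I} (S : QRep.Mor (U β) (U β')) {V : QRep O}
    (X : QRep.Mor (U α) V)
    (T : QRep.Mor (V.tensor (U β')) (U γ)) (x : (M α).E) (y : (M β).E) :
    φ.ev (T ⊚ (X ⊠ S)) x y = φ.ev (T ⊚ (X ⊠ QRep.Mor.id _)) x (irrMap M S y) :=
  hU.schur (motive := fun β β' S => ∀ (T : QRep.Mor (V.tensor (U β')) (U γ)) (y : (M β).E),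
      φ.ev (T ⊚ (X ⊠ S)) x y = φ.ev (T ⊚ (X ⊠ QRep.Mor.id _)) x (irrMap M S y))
    (fun β β' T y => by simp) (fun β c T y => by
      rw [QRep.Mor.tensor_smul, QRep.Mor.comp_smul, map_smul, map_smul, LinearMap.smul_apply,
        LinearMap.smul_apply, LinearMap.smul_apply, irrMap_id hU, map_smul]) S T y

end IrreducibleCalculus

/-! ### The functor on objects and morphisms -/

section Construction

universe u v w z

variable {O : Type u} [Ring O] [StarRing O] [HopfAlgebra ℂ O] [StarModule ℂ O]
  {A : Type v} [NonUnitalCStarAlgebra A] [PartialOrder A] [StarOrderedRing A]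
  {I : Type w} {U : I → QRep O}

namespace IrrepDecomposition

variable {V : QRep O} {ι : Type} [Fintype ι] (d : IrrepDecomposition U V ι)

/-- The projection onto a summand. -/
noncomputable def proj (k : ι) : QRep.Mor V (U (d.idx k)) := QRep.Mor.adj (d.emb k)

@[simp]
theorem adj_emb (k : ι) : QRep.Mor.adj (d.emb k) = d.proj k := rfl

@[simp]
theorem adj_proj (k : ι) : QRep.Mor.adj (d.proj k) = d.emb k := QRep.Mor.adj_adj _

theorem proj_emb_self (k : ι) : d.proj k ⊚ d.emb k = QRep.Mor.id _ := d.adj_emb_self k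

theorem proj_emb_of_ne {k l : ι} (h : k ≠ l) : d.proj k ⊚ d.emb l = 0 := d.adj_emb_of_ne k l h

theorem sum_emb_proj : ∑ k, d.emb k ⊚ d.proj k = QRep.Mor.id V := d.sum_emb

variable {E : Type*} [AddCommGroup E] [Module ℂ E] {W X Y Z : QRep O}

/-- The basic tool: the resolution of the identity of `V`, inserted between `S` and `T` under a
linear map `f`. In the applications `f` is the identity, evaluation of a functor or of `φ` at fixed
vectors, or a natural family of coordinates. -/
theorem sum_map_comp (f : QRep.Mor X Y →ₗ[ℂ] E) (S : QRep.Mor V Y) (T : QRep.Mor X V) :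
    ∑ k, f (S ⊚ d.emb k ⊚ d.proj k ⊚ T) = f (S ⊚ T) := by
  have h : ∀ k, S ⊚ d.emb k ⊚ d.proj k ⊚ T = S ⊚ (d.emb k ⊚ d.proj k) ⊚ T := fun k => rfl
  simp only [h]
  rw [← map_sum, ← QRep.Mor.comp_sum, ← QRep.Mor.sum_comp, d.sum_emb_proj, QRep.Mor.id_comp]

theorem sum_map_tensor_left (f : QRep.Mor (X.tensor Z) Y →ₗ[ℂ] E) (S : QRep.Mor (V.tensor W) Y)
    (T : QRep.Mor X V) (R : QRep.Mor Z W) :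
    ∑ k, f (S ⊚ ((d.emb k ⊚ d.proj k ⊚ T) ⊠ R)) = f (S ⊚ (T ⊠ R)) := by
  have h : ∀ k, d.emb k ⊚ d.proj k ⊚ T = (d.emb k ⊚ d.proj k) ⊚ T := fun k => rfl
  simp only [h]
  rw [← map_sum, ← QRep.Mor.comp_sum, ← QRep.Mor.sum_tensor, ← QRep.Mor.sum_comp, d.sum_emb_proj,
    QRep.Mor.id_comp]

theorem sum_map_tensor_right (f : QRep.Mor (Z.tensor X) Y →ₗ[ℂ] E) (S : QRep.Mor (W.tensor V) Y)
    (R : QRep.Mor Z W) (T : QRep.Mor X V) :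
    ∑ k, f (S ⊚ (R ⊠ (d.emb k ⊚ d.proj k ⊚ T))) = f (S ⊚ (R ⊠ T)) := by
  have h : ∀ k, d.emb k ⊚ d.proj k ⊚ T = (d.emb k ⊚ d.proj k) ⊚ T := fun k => rfl
  simp only [h]
  rw [← map_sum, ← QRep.Mor.comp_sum, ← QRep.Mor.tensor_sum, ← QRep.Mor.sum_comp, d.sum_emb_proj,
    QRep.Mor.id_comp]

end IrrepDecomposition

variable (M : I → Corr.{v, z} A) (hU : IsIrreducibleSystem U)

namespace IsIrreducibleSystem

include hU in
/-- A chosen decomposition of `V`. -/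
noncomputable def dec (V : QRep O) :
    IrrepDecomposition U V (Fin (hU.exists_decomposition_fin V).choose) :=
  (hU.exists_decomposition_fin V).choose_spec.some

/-- The correspondence `F(V)`: the direct sum of the `M_α` along a decomposition of `V`. -/
noncomputable def obj (V : QRep O) : Corr.{v, z} A := Corr.pi fun k => M ((hU.dec V).idx k)

/-- The number of summands of `V`. -/
noncomputable abbrev size (V : QRep O) : ℕ := (hU.exists_decomposition_fin V).choose

variable {M}

/-- The component of an element of `F(V)` in a summand. -/
noncomputable def component (V : QRep O) (k : Fin (hU.size V)) :
    (hU.obj M V).E →ₗ[ℂ] (M ((hU.dec V).idx k)).E :=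
  LinearMap.proj (φ := fun k => (M ((hU.dec V).idx k)).E) k

/-- Linear maps into `F(V)` from their components. -/
noncomputable def ofComponents {E : Type*} [AddCommGroup E] [Module ℂ E] (V : QRep O)
    (f : ∀ k : Fin (hU.size V), E →ₗ[ℂ] (M ((hU.dec V).idx k)).E) : E →ₗ[ℂ] (hU.obj M V).E :=
  LinearMap.pi f

theorem component_ofComponents {E : Type*} [AddCommGroup E] [Module ℂ E] (V : QRep O)
    (f : ∀ k : Fin (hU.size V), E →ₗ[ℂ] (M ((hU.dec V).idx k)).E) (x : E) (k : Fin (hU.size V)) :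
    hU.component V k (hU.ofComponents V f x) = f k x := rfl

theorem obj_ext {V : QRep O} {x y : (hU.obj M V).E}
    (h : ∀ k, hU.component V k x = hU.component V k y) : x = y := funext h

theorem component_lact {V : QRep O} (k : Fin (hU.size V)) (a : A) (x : (hU.obj M V).E) :
    hU.component V k ((hU.obj M V).lact a x) = (M _).lact a (hU.component V k x) := rfl

theorem component_ract {V : QRep O} (k : Fin (hU.size V)) (x : (hU.obj M V).E) (a : A) :
    hU.component V k ((hU.obj M V).ract x a) = (M _).ract (hU.component V k x) a := rfl

theorem obj_inner {V : QRep O} (x y : (hU.obj M V).E) :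
    (hU.obj M V).inner x y
      = ∑ k, (M _).inner (hU.component V k x) (hU.component V k y) := rfl

/-- The map `F(S) : F(V) → F(U_γ) = M_γ`. -/
noncomputable def coord {V : QRep O} {γ : I} (S : QRep.Mor V (U γ)) :
    (hU.obj M V).E →ₗ[ℂ] (M γ).E :=
  ∑ i, irrMap M (S ⊚ (hU.dec V).emb i) ∘ₗ hU.component V i

theorem coord_apply {V : QRep O} {γ : I} (S : QRep.Mor V (U γ)) (x : (hU.obj M V).E) :
    hU.coord S x = ∑ i, irrMap M (S ⊚ (hU.dec V).emb i) (hU.component V i x) := by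
  simp [coord]

theorem coord_add {V : QRep O} {γ : I} (S T : QRep.Mor V (U γ)) (x : (hU.obj M V).E) :
    hU.coord (S + T) x = hU.coord S x + hU.coord T x := by
  simp only [coord_apply, QRep.Mor.add_comp, map_add, LinearMap.add_apply, Finset.sum_add_distrib]

theorem coord_smul {V : QRep O} {γ : I} (c : ℂ) (S : QRep.Mor V (U γ)) (x : (hU.obj M V).E) :
    hU.coord (c • S) x = c • hU.coord S x := by
  simp only [coord_apply, QRep.Mor.smul_comp, map_smul, LinearMap.smul_apply, Finset.smul_sum]

theorem coord_proj {V : QRep O} (k : Fin (hU.size V)) (x : (hU.obj M V).E) :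
    hU.coord ((hU.dec V).proj k) x = hU.component V k x := by
  rw [coord_apply, Finset.sum_eq_single k]
  · rw [(hU.dec V).proj_emb_self, irrMap_id hU]
  · intro i _ hi
    rw [(hU.dec V).proj_emb_of_ne hi.symm, map_zero, LinearMap.zero_apply]
  · simp

theorem coord_comp {V : QRep O} {γ δ : I} (R : QRep.Mor (U γ) (U δ)) (S : QRep.Mor V (U γ))
    (x : (hU.obj M V).E) : hU.coord (R ⊚ S) x = irrMap M R (hU.coord S x) := by
  simp only [coord_apply, map_sum, QRep.Mor.comp_assoc, irrMap_comp hU]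

/-- The element of `F(V)` with components `g (proj k)` has coordinates given by the natural
family `g`. -/
theorem coord_of_natural {V : QRep O} (g : ∀ γ, QRep.Mor V (U γ) →ₗ[ℂ] (M γ).E)
    (hg : ∀ {γ δ} (R : QRep.Mor (U γ) (U δ)) (S : QRep.Mor V (U γ)),
      g δ (R ⊚ S) = irrMap M R (g γ S)) (x : (hU.obj M V).E)
    (hx : ∀ k, hU.component V k x = g _ ((hU.dec V).proj k)) {γ : I} (S : QRep.Mor V (U γ)) :
    hU.coord S x = g γ S := by
  simp only [coord_apply, hx, ← hg]
  exact (hU.dec V).sum_map_comp (g γ) S (QRep.Mor.id V)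

/-- The functor on morphisms. -/
noncomputable def map {V W : QRep O} (T : QRep.Mor V W) :
    (hU.obj M V).E →ₗ[ℂ] (hU.obj M W).E :=
  hU.ofComponents W fun k => hU.coord ((hU.dec W).proj k ⊚ T)

theorem component_map {V W : QRep O} (T : QRep.Mor V W) (k : Fin (hU.size W))
    (x : (hU.obj M V).E) :
    hU.component W k (hU.map T x) = hU.coord ((hU.dec W).proj k ⊚ T) x := rfl

/-- The definition of `map` prescribes this only for the chosen projections; the right-hand side is
natural in `S`, so it extends to all `S`. Functoriality is then formal. -/
theorem coord_map {V W : QRep O} {γ : I} (S : QRep.Mor W (U γ)) (T : QRep.Mor V W)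
    (x : (hU.obj M V).E) : hU.coord S (hU.map T x) = hU.coord (S ⊚ T) x :=
  hU.coord_of_natural
    (fun γ =>
      { toFun := fun S => hU.coord (S ⊚ T) x
        map_add' := fun S S' => by rw [QRep.Mor.add_comp, coord_add]
        map_smul' := fun c S => by rw [QRep.Mor.smul_comp, coord_smul, RingHom.id_apply] })
    (fun R S => hU.coord_comp R (S ⊚ T) x) _ (fun k => hU.component_map T k x) S

theorem map_id (V : QRep O) (x : (hU.obj M V).E) : hU.map (QRep.Mor.id V) x = x :=
  hU.obj_ext fun k => by rw [component_map, QRep.Mor.comp_id, coord_proj]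

theorem map_comp {V W X : QRep O} (S : QRep.Mor W X) (T : QRep.Mor V W) (x : (hU.obj M V).E) :
    hU.map (S ⊚ T) x = hU.map S (hU.map T x) :=
  hU.obj_ext fun k => by rw [component_map, component_map, coord_map, QRep.Mor.comp_assoc]

theorem coord_lact {V : QRep O} {γ : I} (S : QRep.Mor V (U γ)) (a : A) (x : (hU.obj M V).E) :
    hU.coord S ((hU.obj M V).lact a x) = (M γ).lact a (hU.coord S x) := by
  simp only [coord_apply, component_lact, irrMap_lact hU, map_sum]

theorem coord_ract {V : QRep O} {γ : I} (S : QRep.Mor V (U γ)) (x : (hU.obj M V).E) (a : A) :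
    hU.coord S ((hU.obj M V).ract x a) = (M γ).ract (hU.coord S x) a := by
  simp only [coord_apply, component_ract, irrMap_ract hU, map_sum, LinearMap.sum_apply]

theorem map_lact {V W : QRep O} (T : QRep.Mor V W) (a : A) (x : (hU.obj M V).E) :
    hU.map T ((hU.obj M V).lact a x) = (hU.obj M W).lact a (hU.map T x) :=
  hU.obj_ext fun k => by rw [component_map, component_lact, component_map, coord_lact]

theorem map_ract {V W : QRep O} (T : QRep.Mor V W) (x : (hU.obj M V).E) (a : A) :
    hU.map T ((hU.obj M V).ract x a) = (hU.obj M W).ract (hU.map T x) a :=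
  hU.obj_ext fun k => by rw [component_map, component_ract, component_map, coord_ract]

/-- The matrix of `F(T)` has the entries `proj k ∘ T ∘ emb i`, and the adjoint of such an entry is
the transposed entry of `T*`. -/
theorem inner_map {V W : QRep O} (T : QRep.Mor V W) (x : (hU.obj M V).E) (y : (hU.obj M W).E) :
    (hU.obj M W).inner (hU.map T x) y = (hU.obj M V).inner x (hU.map (QRep.Mor.adj T) y) := by
  simp only [obj_inner, component_map, coord_apply, map_sum, LinearMap.sum_apply]
  rw [Finset.sum_comm]
  refine Finset.sum_congr rfl fun i _ => Finset.sum_congr rfl fun k _ => ?_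
  rw [inner_irrMap hU, QRep.Mor.adj_comp, QRep.Mor.adj_comp, IrrepDecomposition.adj_proj,
    IrrepDecomposition.adj_emb, QRep.Mor.comp_assoc]

/-- The functor on morphisms, with values in the morphisms of `Hilb A`. -/
noncomputable def mapMor {V W : QRep O} :
    QRep.Mor V W →ₗ[ℂ] Corr.Mor (hU.obj M V) (hU.obj M W) where
  toFun T := ⟨hU.map T, hU.map_lact T, hU.map_ract T, hU.map (QRep.Mor.adj T), hU.inner_map T⟩
  map_add' S T := Subtype.ext <| LinearMap.ext fun x => hU.obj_ext fun k => by
    change hU.component W k (hU.map (S + T) x)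
      = hU.component W k (hU.map S x) + hU.component W k (hU.map T x)
    simp only [component_map, QRep.Mor.comp_add, coord_add]
  map_smul' c T := Subtype.ext <| LinearMap.ext fun x => hU.obj_ext fun k => by
    change hU.component W k (hU.map (c • T) x) = c • hU.component W k (hU.map T x)
    simp only [component_map, QRep.Mor.comp_smul, coord_smul]

/-- The map `F(T) : M_α = F(U_α) → F(V)`. -/
noncomputable def incl {V : QRep O} {α : I} (T : QRep.Mor (U α) V) :
    (M α).E →ₗ[ℂ] (hU.obj M V).E :=
  hU.ofComponents V fun k => irrMap M ((hU.dec V).proj k ⊚ T)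

theorem component_incl {V : QRep O} {α : I} (T : QRep.Mor (U α) V) (k : Fin (hU.size V))
    (x : (M α).E) :
    hU.component V k (hU.incl T x) = irrMap M ((hU.dec V).proj k ⊚ T) x := rfl

theorem coord_incl {V : QRep O} {α γ : I} (S : QRep.Mor V (U γ)) (T : QRep.Mor (U α) V)
    (x : (M α).E) : hU.coord S (hU.incl T x) = irrMap M (S ⊚ T) x :=
  hU.coord_of_natural
    (fun γ =>
      { toFun := fun S => irrMap M (S ⊚ T) x
        map_add' := fun S S' => by rw [QRep.Mor.add_comp, map_add, LinearMap.add_apply]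
        map_smul' := fun c S => by
          rw [QRep.Mor.smul_comp, map_smul, LinearMap.smul_apply, RingHom.id_apply] })
    (fun R S => by
      rw [LinearMap.coe_mk, AddHom.coe_mk, QRep.Mor.comp_assoc, irrMap_comp hU]
      rfl) _ (fun k => hU.component_incl T k x) S

theorem incl_coord {V : QRep O} {α : I} (T : QRep.Mor (U α) V) (S : QRep.Mor V (U α))
    (x : (hU.obj M V).E) : hU.incl T (hU.coord S x) = hU.map (T ⊚ S) x :=
  hU.obj_ext fun k => by
    rw [component_incl, component_map, ← coord_comp, QRep.Mor.comp_assoc]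

theorem map_incl {V W : QRep O} {α : I} (S : QRep.Mor V W) (T : QRep.Mor (U α) V) (x : (M α).E) :
    hU.map S (hU.incl T x) = hU.incl (S ⊚ T) x :=
  hU.obj_ext fun k => by
    rw [component_map, coord_incl, component_incl, QRep.Mor.comp_assoc]

theorem inner_incl {V : QRep O} {α : I} (T : QRep.Mor (U α) V) (x : (M α).E)
    (y : (hU.obj M V).E) :
    (hU.obj M V).inner (hU.incl T x) y = (M α).inner x (hU.coord (QRep.Mor.adj T) y) := by
  rw [obj_inner, coord_apply, map_sum]
  refine Finset.sum_congr rfl fun k _ => ?_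
  rw [component_incl, inner_irrMap hU, QRep.Mor.adj_comp, IrrepDecomposition.adj_proj]

/-- A unitary `U_α → V` induces a unitary isomorphism `M_α → F(V)`. -/
noncomputable def inclIso {V : QRep O} {α : I} (T : QRep.Mor (U α) V)
    (hT : QRep.Mor.IsUnitary T) : Corr.UnitaryIso (M α) (hU.obj M V) where
  toEquiv := LinearEquiv.ofLinearMap (hU.incl T) (hU.coord (QRep.Mor.adj T))
    (LinearMap.ext fun x => by
      rw [LinearMap.comp_apply, incl_coord, hT.2, map_id, LinearMap.id_apply])
    (LinearMap.ext fun x => by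
      rw [LinearMap.comp_apply, coord_incl, hT.1, irrMap_id hU, LinearMap.id_apply])
  map_lact a x := hU.obj_ext fun k => by
    rw [component_lact]
    exact irrMap_lact hU _ a x
  map_ract x a := hU.obj_ext fun k => by
    rw [component_ract]
    exact irrMap_ract hU _ x a
  map_inner x y := by
    change (hU.obj M V).inner (hU.incl T x) (hU.incl T y) = (M α).inner x y
    rw [inner_incl, coord_incl, hT.1, irrMap_id hU]

end IsIrreducibleSystem

end Construction

/-! ### The maps `F₂`: naturality and isometry -/

section Multiplication

universe u v w z

variable {O : Type u} [Ring O] [StarRing O] [HopfAlgebra ℂ O] [StarModule ℂ O]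
  {A : Type v} [NonUnitalCStarAlgebra A] [PartialOrder A] [StarOrderedRing A]
  {I : Type w} {U : I → QRep O} {M : I → Corr.{v, z} A} (hU : IsIrreducibleSystem U)
  (φ : BilinSystem U M)

/-- Pythagoras in a direct sum: the cross terms vanish only after summation over the coordinates
`k`. -/
theorem Corr.sum_inner_sum_of_orthogonal {κ P : Type*} [Fintype κ] [Fintype P]
    (N : κ → Corr.{v, z} A) (u w : P → ∀ k, (N k).E)
    (h : ∀ p q, p ≠ q → ∑ k, (N k).inner (u p k) (w q k) = 0) :
    ∑ k, (N k).inner (∑ p, u p k) (∑ p, w p k) = ∑ p, ∑ k, (N k).inner (u p k) (w p k) := by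
  simp only [map_sum, LinearMap.sum_apply]
  rw [Finset.sum_comm]
  refine Finset.sum_congr rfl fun p _ => ?_
  rw [Finset.sum_comm, Finset.sum_eq_single p (fun q _ hq => ?_) (by simp)]
  exact h q p hq

namespace BilinSystem

variable {V W : QRep O} {ι : Type} [Fintype ι] (d : IrrepDecomposition U V ι)

/-- The map `T ↦ φ(T)(x ⊗ y)`. -/
noncomputable def evAt {α β γ : I} (x : (M α).E) (y : (M β).E) :
    QRep.Mor ((U α).tensor (U β)) (U γ) →ₗ[ℂ] (M γ).E :=
  (LinearMap.applyₗ y ∘ₗ LinearMap.applyₗ x) ∘ₗ φ.ev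

theorem sum_ev_comp {α β γ : I} (S : QRep.Mor V (U γ)) (T : QRep.Mor ((U α).tensor (U β)) V)
    (x : (M α).E) (y : (M β).E) :
    ∑ k, φ.ev (S ⊚ d.emb k ⊚ d.proj k ⊚ T) x y = φ.ev (S ⊚ T) x y :=
  d.sum_map_comp (φ.evAt x y) S T

include hU

/-- The morphism `proj k ∘ S` between irreducibles moves from the vector `x` into the argument of
`φ`, where it meets `emb k` and the sum over `k` collapses. -/
theorem sum_ev_tensor_left {α β γ : I} (T : QRep.Mor (V.tensor W) (U γ)) (S : QRep.Mor (U α) V)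
    (R : QRep.Mor (U β) W) (x : (M α).E) (y : (M β).E) :
    ∑ k, φ.ev (T ⊚ (d.emb k ⊠ R)) (irrMap M (d.proj k ⊚ S) x) y = φ.ev (T ⊚ (S ⊠ R)) x y := by
  refine Eq.trans (Finset.sum_congr rfl fun k _ => ?_) (d.sum_map_tensor_left (φ.evAt x y) T S R)
  have h := φ.ev_tensor_id hU (d.proj k ⊚ S) (QRep.Mor.id (U β)) (T ⊚ (d.emb k ⊠ R)) x y
  rw [QRep.Mor.id_tensor_id, QRep.Mor.comp_id, QRep.Mor.comp_assoc, ← QRep.Mor.tensor_comp,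
    QRep.Mor.comp_id] at h
  exact h.symm

theorem sum_ev_tensor_right {α β γ : I} (T : QRep.Mor (W.tensor V) (U γ)) (R : QRep.Mor (U α) W)
    (S : QRep.Mor (U β) V) (x : (M α).E) (y : (M β).E) :
    ∑ k, φ.ev (T ⊚ (R ⊠ d.emb k)) x (irrMap M (d.proj k ⊚ S) y) = φ.ev (T ⊚ (R ⊠ S)) x y := by
  refine Eq.trans (Finset.sum_congr rfl fun k _ => ?_) (d.sum_map_tensor_right (φ.evAt x y) T R S)
  have h := φ.ev_id_tensor hU (d.proj k ⊚ S) (QRep.Mor.id (U α)) (T ⊚ (R ⊠ d.emb k)) x y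
  rw [QRep.Mor.id_tensor_id, QRep.Mor.comp_id, QRep.Mor.comp_assoc, ← QRep.Mor.tensor_comp,
    QRep.Mor.comp_id] at h
  exact h.symm

end BilinSystem

namespace IsIrreducibleSystem

/-- The extension of `φ` to arbitrary representations in the two source variables: the map
`F(T) F₂ : F(V) ⊗ F(W) → M_γ`. -/
noncomputable def bilin {V W : QRep O} {γ : I} (T : QRep.Mor (V.tensor W) (U γ)) :
    (hU.obj M V).E →ₗ[ℂ] (hU.obj M W).E →ₗ[ℂ] (M γ).E :=
  ∑ i, ∑ l, (φ.ev (T ⊚ ((hU.dec V).emb i ⊠ (hU.dec W).emb l))).compl₁₂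
    (hU.component V i) (hU.component W l)

theorem bilin_apply {V W : QRep O} {γ : I} (T : QRep.Mor (V.tensor W) (U γ))
    (x : (hU.obj M V).E) (y : (hU.obj M W).E) :
    hU.bilin φ T x y = ∑ i, ∑ l, φ.ev (T ⊚ ((hU.dec V).emb i ⊠ (hU.dec W).emb l))
      (hU.component V i x) (hU.component W l y) := by
  simp [bilin, LinearMap.sum_apply]

theorem bilin_add {V W : QRep O} {γ : I} (S T : QRep.Mor (V.tensor W) (U γ))
    (x : (hU.obj M V).E) (y : (hU.obj M W).E) :
    hU.bilin φ (S + T) x y = hU.bilin φ S x y + hU.bilin φ T x y := by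
  simp only [bilin_apply, QRep.Mor.add_comp, map_add, LinearMap.add_apply, Finset.sum_add_distrib]

theorem bilin_smul {V W : QRep O} {γ : I} (c : ℂ) (T : QRep.Mor (V.tensor W) (U γ))
    (x : (hU.obj M V).E) (y : (hU.obj M W).E) :
    hU.bilin φ (c • T) x y = c • hU.bilin φ T x y := by
  simp only [bilin_apply, QRep.Mor.smul_comp, map_smul, LinearMap.smul_apply, Finset.smul_sum]

theorem bilin_comp {V W : QRep O} {γ δ : I} (R : QRep.Mor (U γ) (U δ))
    (T : QRep.Mor (V.tensor W) (U γ)) (x : (hU.obj M V).E) (y : (hU.obj M W).E) :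
    hU.bilin φ (R ⊚ T) x y = irrMap M R (hU.bilin φ T x y) := by
  simp only [bilin_apply, QRep.Mor.comp_assoc, φ.ev_comp hU, map_sum]

/-- The maps `F₂`. -/
noncomputable def mul (V W : QRep O) :
    (hU.obj M V).E →ₗ[ℂ] (hU.obj M W).E →ₗ[ℂ] (hU.obj M (V.tensor W)).E :=
  LinearMap.mk₂ ℂ
    (fun x y => hU.ofComponents (E := (hU.obj M W).E) (V.tensor W)
      (fun k => hU.bilin φ ((hU.dec (V.tensor W)).proj k) x) y)
    (fun x x' y => hU.obj_ext fun k => by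
      rw [map_add]; simp only [component_ofComponents, map_add, LinearMap.add_apply])
    (fun c x y => hU.obj_ext fun k => by
      rw [map_smul]; simp only [component_ofComponents, map_smul, LinearMap.smul_apply])
    (fun x y y' => map_add _ y y') (fun c x y => map_smul _ c y)

theorem component_mul {V W : QRep O} (x : (hU.obj M V).E) (y : (hU.obj M W).E)
    (k : Fin (hU.size (V.tensor W))) :
    hU.component (V.tensor W) k (hU.mul φ V W x y)
      = hU.bilin φ ((hU.dec (V.tensor W)).proj k) x y := rfl

/-- `bilin` is natural in the target, so the defining property of `F₂` at the chosen projections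
holds at every `S`. -/
theorem coord_mul {V W : QRep O} {γ : I} (S : QRep.Mor (V.tensor W) (U γ)) (x : (hU.obj M V).E)
    (y : (hU.obj M W).E) : hU.coord S (hU.mul φ V W x y) = hU.bilin φ S x y :=
  hU.coord_of_natural
    (fun _ =>
      { toFun := fun S => hU.bilin φ S x y
        map_add' := fun S S' => hU.bilin_add φ S S' x y
        map_smul' := fun c S => hU.bilin_smul φ c S x y })
    (fun R S => hU.bilin_comp φ R S x y) _ (fun k => hU.component_mul φ x y k) S

/-- `φ(T (emb ⊠ R))` summed against the components of `F(S)x`. -/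
theorem sum_ev_coord_left {V V' W : QRep O} {β γ : I} (T : QRep.Mor (V'.tensor W) (U γ))
    (S : QRep.Mor V V') (R : QRep.Mor (U β) W) (x : (hU.obj M V).E) (y : (M β).E) :
    ∑ i, φ.ev (T ⊚ ((hU.dec V').emb i ⊠ R)) (hU.coord ((hU.dec V').proj i ⊚ S) x) y
      = ∑ i, φ.ev (T ⊚ ((S ⊚ (hU.dec V).emb i) ⊠ R)) (hU.component V i x) y := by
  simp only [coord_apply, map_sum, LinearMap.sum_apply, QRep.Mor.comp_assoc]
  rw [Finset.sum_comm]
  exact Finset.sum_congr rfl fun i _ => φ.sum_ev_tensor_left hU _ _ _ _ _ _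

theorem sum_ev_coord_right {V W W' : QRep O} {α γ : I} (T : QRep.Mor (V.tensor W') (U γ))
    (R : QRep.Mor (U α) V) (S : QRep.Mor W W') (x : (M α).E) (y : (hU.obj M W).E) :
    ∑ i, φ.ev (T ⊚ (R ⊠ (hU.dec W').emb i)) x (hU.coord ((hU.dec W').proj i ⊚ S) y)
      = ∑ i, φ.ev (T ⊚ (R ⊠ (S ⊚ (hU.dec W).emb i))) x (hU.component W i y) := by
  simp only [coord_apply, map_sum, QRep.Mor.comp_assoc]
  rw [Finset.sum_comm]
  exact Finset.sum_congr rfl fun i _ => φ.sum_ev_tensor_right hU _ _ _ _ _ _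

theorem bilin_tensor {V W V' W' : QRep O} {γ : I} (T : QRep.Mor (V'.tensor W') (U γ))
    (S : QRep.Mor V V') (S' : QRep.Mor W W') (x : (hU.obj M V).E) (y : (hU.obj M W).E) :
    hU.bilin φ (T ⊚ (S ⊠ S')) x y = hU.bilin φ T (hU.map S x) (hU.map S' y) := by
  simp only [bilin_apply, component_map, sum_ev_coord_right]
  -- The sum over the summands of `W'` has been traded for one over those of `W`; exchanging the
  -- order exposes the inner sum over the summands of `V'`.
  rw [Finset.sum_comm]
  conv_rhs => rw [Finset.sum_comm]
  simp only [sum_ev_coord_left, QRep.Mor.comp_assoc, ← QRep.Mor.tensor_comp]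

theorem map_tensor_mul {V W V' W' : QRep O} (S : QRep.Mor V V') (T : QRep.Mor W W')
    (x : (hU.obj M V).E) (y : (hU.obj M W).E) :
    hU.map (S ⊠ T) (hU.mul φ V W x y) = hU.mul φ V' W' (hU.map S x) (hU.map T y) :=
  hU.obj_ext fun k => by rw [component_map, coord_mul, component_mul, bilin_tensor]

theorem bilin_incl_left {V W : QRep O} {α γ : I} (T : QRep.Mor (V.tensor W) (U γ))
    (S : QRep.Mor (U α) V) (x : (M α).E) (y : (hU.obj M W).E) :
    hU.bilin φ T (hU.incl S x) y
      = ∑ l, φ.ev (T ⊚ (S ⊠ (hU.dec W).emb l)) x (hU.component W l y) := by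
  simp only [bilin_apply, component_incl]
  rw [Finset.sum_comm]
  exact Finset.sum_congr rfl fun l _ => φ.sum_ev_tensor_left hU _ _ _ _ _ _

theorem bilin_incl_right {V W : QRep O} {β γ : I} (T : QRep.Mor (V.tensor W) (U γ))
    (S : QRep.Mor (U β) W) (x : (hU.obj M V).E) (y : (M β).E) :
    hU.bilin φ T x (hU.incl S y)
      = ∑ i, φ.ev (T ⊚ ((hU.dec V).emb i ⊠ S)) (hU.component V i x) y := by
  simp only [bilin_apply, component_incl]
  exact Finset.sum_congr rfl fun i _ => φ.sum_ev_tensor_right hU _ _ _ _ _ _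

theorem bilin_incl_incl {V W : QRep O} {α β γ : I} (T : QRep.Mor (V.tensor W) (U γ))
    (S : QRep.Mor (U α) V) (S' : QRep.Mor (U β) W) (x : (M α).E) (y : (M β).E) :
    hU.bilin φ T (hU.incl S x) (hU.incl S' y) = φ.ev (T ⊚ (S ⊠ S')) x y := by
  rw [bilin_incl_left]
  exact φ.sum_ev_tensor_right hU _ _ _ _ _ _

variable {e : I} {t : QRep.Mor (U e) (QRep.one O)} {j : Corr.UnitaryIso (Corr.self A) (M e)}

theorem bilin_lact {V W : QRep O} {γ : I} (T : QRep.Mor (V.tensor W) (U γ)) (a : A)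
    (x : (hU.obj M V).E) (y : (hU.obj M W).E) :
    hU.bilin φ T ((hU.obj M V).lact a x) y = (M γ).lact a (hU.bilin φ T x y) := by
  simp only [bilin_apply, component_lact, map_sum]
  exact Finset.sum_congr rfl fun i _ => Finset.sum_congr rfl fun l _ => (φ _ _ _ _).2.1 _ _ _

theorem bilin_ract {V W : QRep O} {γ : I} (T : QRep.Mor (V.tensor W) (U γ))
    (x : (hU.obj M V).E) (y : (hU.obj M W).E) (a : A) :
    hU.bilin φ T x ((hU.obj M W).ract y a) = (M γ).ract (hU.bilin φ T x y) a := by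
  simp only [bilin_apply, component_ract, map_sum, LinearMap.sum_apply]
  exact Finset.sum_congr rfl fun i _ => Finset.sum_congr rfl fun l _ => (φ _ _ _ _).2.2.1 _ _ _

theorem bilin_balanced {V W : QRep O} {γ : I} (T : QRep.Mor (V.tensor W) (U γ))
    (x : (hU.obj M V).E) (a : A) (y : (hU.obj M W).E) :
    hU.bilin φ T ((hU.obj M V).ract x a) y = hU.bilin φ T x ((hU.obj M W).lact a y) := by
  simp only [bilin_apply, component_ract, component_lact]
  exact Finset.sum_congr rfl fun i _ => Finset.sum_congr rfl fun l _ => (φ _ _ _ _).2.2.2.1 _ _ _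

variable {φ}

/-- The inner products of `F(B)F₂` and `F(C)F₂`, for `B` and `C` with values in `W`, in terms of a
decomposition of the source of `B`. -/
theorem sum_inner_ev {α β α' β' : I} {W : QRep O} (B : QRep.Mor ((U α).tensor (U β)) W)
    (C : QRep.Mor ((U α').tensor (U β')) W) (x : (M α).E) (y : (M β).E) (x' : (M α').E)
    (y' : (M β').E) :
    ∑ k, (M _).inner (φ.ev ((hU.dec W).proj k ⊚ B) x y) (φ.ev ((hU.dec W).proj k ⊚ C) x' y')
      = ∑ m, (M _).inner (φ.ev ((hU.dec ((U α).tensor (U β))).proj m) x y)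
          (φ.ev ((hU.dec ((U α).tensor (U β))).proj m ⊚ QRep.Mor.adj B ⊚ C) x' y') := by
  set d := hU.dec ((U α).tensor (U β)) with hd
  -- The morphisms `proj k ∘ B ∘ emb m` join irreducibles. They come out of `φ` and pass to the
  -- other side of the inner product as adjoints, where the sum over `k` leaves `B* C`.
  have h1 : ∀ k, φ.ev ((hU.dec W).proj k ⊚ B) x y
      = ∑ m, irrMap M ((hU.dec W).proj k ⊚ B ⊚ d.emb m) (φ.ev (d.proj m) x y) := fun k => by
    rw [← QRep.Mor.comp_id (_ ⊚ B), ← φ.sum_ev_comp d]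
    exact Finset.sum_congr rfl fun m _ =>
      φ.ev_comp hU ((hU.dec W).proj k ⊚ B ⊚ d.emb m) (d.proj m) x y
  simp only [h1, map_sum, LinearMap.sum_apply]
  rw [Finset.sum_comm]
  refine Finset.sum_congr rfl fun m _ => ?_
  simp only [inner_irrMap hU]
  simp only [← φ.ev_comp hU]
  rw [← map_sum, ← QRep.Mor.comp_assoc (d.proj m), ← φ.sum_ev_comp (hU.dec W)]
  refine congrArg _ (Finset.sum_congr rfl fun k _ => ?_)
  rw [QRep.Mor.adj_comp, QRep.Mor.adj_comp, IrrepDecomposition.adj_proj,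
    IrrepDecomposition.adj_emb]
  rfl

variable (hφ : φ.IsCoherent e t j)

include hφ

/-- By `sum_inner_ev` the sum depends on `C` only through `B* C`. -/
theorem sum_inner_ev_of_orthogonal {α β α' β' : I} {W : QRep O}
    (B : QRep.Mor ((U α).tensor (U β)) W) (C : QRep.Mor ((U α').tensor (U β')) W)
    (hBC : QRep.Mor.adj B ⊚ C = 0) (x : (M α).E) (y : (M β).E) (x' : (M α').E) (y' : (M β').E) :
    ∑ k, (M _).inner (φ.ev ((hU.dec W).proj k ⊚ B) x y) (φ.ev ((hU.dec W).proj k ⊚ C) x' y')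
      = 0 := by
  rw [hU.sum_inner_ev]
  refine Finset.sum_eq_zero fun m _ => ?_
  rw [hBC, QRep.Mor.comp_zero, map_zero, LinearMap.zero_apply, LinearMap.zero_apply, map_zero]

/-- The components `proj k ∘ B` need not form a unitary, so (ii) does not apply to them directly. As
`B* B = id`, `sum_inner_ev` replaces them by the chosen decomposition of `U_α × U_β`, which is
unitary. -/
theorem sum_inner_ev_of_isometry {α β : I} {W : QRep O} (B : QRep.Mor ((U α).tensor (U β)) W)
    (hB : QRep.Mor.adj B ⊚ B = QRep.Mor.id _) (x : (M α).E) (y : (M β).E) (x' : (M α).E)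
    (y' : (M β).E) :
    ∑ k, (M _).inner (φ.ev ((hU.dec W).proj k ⊚ B) x y) (φ.ev ((hU.dec W).proj k ⊚ B) x' y')
      = (M β).inner y ((M β).lact ((M α).inner x x') y') := by
  rw [hU.sum_inner_ev, hB]
  refine hφ.isometric α β _ _ (fun m => (hU.dec ((U α).tensor (U β))).proj m) ?_ (fun m => ?_)
    (fun m l h => ?_) x x' y y'
  · simp only [IrrepDecomposition.adj_proj, IrrepDecomposition.sum_emb_proj]
  · rw [IrrepDecomposition.adj_proj, IrrepDecomposition.proj_emb_self]
  · rw [IrrepDecomposition.adj_proj, IrrepDecomposition.proj_emb_of_ne _ h]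

/-- The morphisms `emb i ⊗ emb l` are isometries with orthogonal ranges. Different pairs of
components contribute nothing to the inner product, and each single pair contributes the inner
product of the tensor product. -/
theorem mul_isometric (V W : QRep O) :
    Corr.IsIsometricBilin (hU.obj M V) (hU.obj M W) (hU.obj M (V.tensor W)) (hU.mul φ V W) := by
  refine ⟨fun a x y => hU.obj_ext fun k => ?_, fun x y a => hU.obj_ext fun k => ?_,
    fun x a y => hU.obj_ext fun k => ?_, fun x y x' y' => ?_⟩
  · rw [component_lact, component_mul, component_mul, bilin_lact]
  · rw [component_ract, component_mul, component_mul, bilin_ract]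
  · rw [component_mul, component_mul, bilin_balanced]
  have key : ∀ i l i' l', (i ≠ i' ∨ l ≠ l') →
      ∑ k, (M _).inner (φ.ev ((hU.dec (V.tensor W)).proj k ⊚
            ((hU.dec V).emb i ⊠ (hU.dec W).emb l)) (hU.component V i x) (hU.component W l y))
          (φ.ev ((hU.dec (V.tensor W)).proj k ⊚
            ((hU.dec V).emb i' ⊠ (hU.dec W).emb l')) (hU.component V i' x')
              (hU.component W l' y')) = 0 := fun i l i' l' h => by
    refine hU.sum_inner_ev_of_orthogonal hφ _ _ ?_ _ _ _ _
    rw [QRep.Mor.adj_tensor, ← QRep.Mor.tensor_comp]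
    rcases h with h | h
    · rw [(hU.dec V).adj_emb_of_ne _ _ h, QRep.Mor.zero_tensor]
    · rw [(hU.dec W).adj_emb_of_ne _ _ h, QRep.Mor.tensor_zero]
  have key' : ∀ i l,
      ∑ k, (M _).inner (φ.ev ((hU.dec (V.tensor W)).proj k ⊚
            ((hU.dec V).emb i ⊠ (hU.dec W).emb l)) (hU.component V i x) (hU.component W l y))
          (φ.ev ((hU.dec (V.tensor W)).proj k ⊚
            ((hU.dec V).emb i ⊠ (hU.dec W).emb l)) (hU.component V i x')
              (hU.component W l y'))
        = (M _).inner (hU.component W l y) ((M _).lact ((M _).inner (hU.component V i x)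
          (hU.component V i x')) (hU.component W l y')) := fun i l => by
    refine hU.sum_inner_ev_of_isometry hφ _ ?_ _ _ _ _
    rw [QRep.Mor.adj_tensor, ← QRep.Mor.tensor_comp, (hU.dec V).adj_emb_self,
      (hU.dec W).adj_emb_self, QRep.Mor.id_tensor_id]
  simp only [obj_inner, component_mul, component_lact, bilin_apply]
  simp only [← Fintype.sum_prod_type']
  rw [Corr.sum_inner_sum_of_orthogonal, Fintype.sum_prod_type_right]
  · simp only [key', map_sum, LinearMap.sum_apply]
  · rintro ⟨i, l⟩ ⟨i', l'⟩ h
    refine key i l i' l' ?_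
    by_contra! hc
    exact h (Prod.ext hc.1 hc.2)

end IsIrreducibleSystem

end Multiplication

/-! ### Associativity, units, adjoints and the existence of the functor -/

section Existence

universe u v w z

theorem Fintype.sum_rotate_three {a b c E : Type*} [Fintype a] [Fintype b] [Fintype c]
    [AddCommMonoid E] (f : a → b → c → E) :
    ∑ i, ∑ k, ∑ l, f i k l = ∑ k, ∑ l, ∑ i, f i k l := by
  rw [Finset.sum_comm]
  exact Finset.sum_congr rfl fun k _ => Finset.sum_comm

theorem Fintype.sum_reorder_four {a b c d E : Type*} [Fintype a] [Fintype b] [Fintype c]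
    [Fintype d] [AddCommMonoid E] (f : a → b → c → d → E) :
    ∑ i, ∑ k, ∑ l, ∑ m, f i k l m = ∑ l, ∑ m, ∑ k, ∑ i, f i k l m := by
  have h : ∀ i, ∑ k, ∑ l, ∑ m, f i k l m = ∑ l, ∑ m, ∑ k, f i k l m :=
    fun i => Fintype.sum_rotate_three _
  simp only [h]
  rw [Fintype.sum_rotate_three]
  exact Finset.sum_congr rfl fun l _ => Finset.sum_congr rfl fun m _ => Finset.sum_comm

variable {O : Type u} [Ring O] [StarRing O] [HopfAlgebra ℂ O] [StarModule ℂ O]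
  {A : Type v} [NonUnitalCStarAlgebra A] [PartialOrder A] [StarOrderedRing A]

/-- An adjoint is automatically linear because the inner product is nondegenerate. Linearity is
needed to move adjoints through finite sums. -/
theorem Corr.exists_linear_adjoint {N P : Corr.{v, z} A} (f : N.E →ₗ[ℂ] P.E)
    (h : ∃ g, Corr.IsAdjoint N P f g) : ∃ g : P.E →ₗ[ℂ] N.E, Corr.IsAdjoint N P f g := by
  obtain ⟨g, hg⟩ := h
  refine ⟨{ toFun := g, map_add' := fun x y => ?_, map_smul' := fun c x => ?_ }, hg⟩
  · refine N.ext_inner fun w => ?_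
    rw [map_add, ← hg, ← hg, ← hg, map_add]
  · refine N.ext_inner fun w => ?_
    rw [RingHom.id_apply, map_smul, ← hg, ← hg, map_smul]

variable {I : Type w} {U : I → QRep O} {M : I → Corr.{v, z} A} (hU : IsIrreducibleSystem U)
  {φ : BilinSystem U M} {e : I} {t : QRep.Mor (U e) (QRep.one O)}
  {j : Corr.UnitaryIso (Corr.self A) (M e)} (hφ : φ.IsCoherent e t j)

/-- The adjoint of `y ↦ φ(T)(x ⊗ y)`. -/
noncomputable def BilinSystem.IsCoherent.evAdj (hφ : φ.IsCoherent e t j) {α β γ : I}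
    (T : QRep.Mor ((U α).tensor (U β)) (U γ)) (x : (M α).E) : (M γ).E →ₗ[ℂ] (M β).E :=
  (Corr.exists_linear_adjoint (φ.ev T x) (hφ.adjointable α β γ T x)).choose

theorem BilinSystem.IsCoherent.inner_evAdj (hφ : φ.IsCoherent e t j) {α β γ : I}
    (T : QRep.Mor ((U α).tensor (U β)) (U γ)) (x : (M α).E) :
    Corr.IsAdjoint (M β) (M γ) (φ.ev T x) (hφ.evAdj T x) :=
  (Corr.exists_linear_adjoint (φ.ev T x) (hφ.adjointable α β γ T x)).choose_spec

namespace IsIrreducibleSystem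

include hφ

/-- Condition (iv) for the displayed morphisms. On both sides the resolution of the identity
collapses, and what remains is the naturality of the associator: `S ∘ assoc ∘ ((B ⊗ C) ⊗ D) = S ∘ (B
⊗ (C ⊗ D)) ∘ assoc`. -/
theorem sum_ev_assoc {V W X : QRep O} {α β γ δ : I}
    (S : QRep.Mor (V.tensor (W.tensor X)) (U δ)) (B : QRep.Mor (U α) V) (C : QRep.Mor (U β) W)
    (D : QRep.Mor (U γ) X) (x : (M α).E) (y : (M β).E) (w : (M γ).E) :
    ∑ m, φ.ev ((S ⊚ QRep.Mor.assoc V W X) ⊚ ((hU.dec (V.tensor W)).emb m ⊠ D))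
        (φ.ev ((hU.dec (V.tensor W)).proj m ⊚ (B ⊠ C)) x y) w
      = ∑ q, φ.ev (S ⊚ (B ⊠ (hU.dec (W.tensor X)).emb q)) x
        (φ.ev ((hU.dec (W.tensor X)).proj q ⊚ (C ⊠ D)) y w) := by
  refine hφ.assoc α β γ δ _ _ _ _ _ (fun m => (S ⊚ QRep.Mor.assoc V W X) ⊚
    ((hU.dec (V.tensor W)).emb m ⊠ D)) _ (fun q => S ⊚ (B ⊠ (hU.dec (W.tensor X)).emb q)) ?_ x y w
  have h1 : ∀ m, ((S ⊚ QRep.Mor.assoc V W X) ⊚ ((hU.dec (V.tensor W)).emb m ⊠ D)) ⊚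
      (((hU.dec (V.tensor W)).proj m ⊚ (B ⊠ C)) ⊠ QRep.Mor.id _)
      = (S ⊚ QRep.Mor.assoc V W X) ⊚ (((hU.dec (V.tensor W)).emb m ⊚
        (hU.dec (V.tensor W)).proj m ⊚ (B ⊠ C)) ⊠ D) := fun m => by
    rw [QRep.Mor.comp_assoc, ← QRep.Mor.tensor_comp, QRep.Mor.comp_id]
  have h2 : ∀ q, (S ⊚ (B ⊠ (hU.dec (W.tensor X)).emb q)) ⊚
      (QRep.Mor.id _ ⊠ ((hU.dec (W.tensor X)).proj q ⊚ (C ⊠ D))) ⊚ QRep.Mor.assoc _ _ _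
      = (S ⊚ (B ⊠ ((hU.dec (W.tensor X)).emb q ⊚ (hU.dec (W.tensor X)).proj q ⊚ (C ⊠ D)))) ⊚
        QRep.Mor.assoc _ _ _ := fun q => by
    rw [← QRep.Mor.comp_assoc, QRep.Mor.comp_assoc S, ← QRep.Mor.tensor_comp, QRep.Mor.comp_id]
  simp only [h1, h2]
  rw [← QRep.Mor.sum_comp]
  refine ((hU.dec (V.tensor W)).sum_map_tensor_left LinearMap.id _ (B ⊠ C) D).trans ?_
  refine Eq.trans ?_ (congrArg (fun Z => Z ⊚ QRep.Mor.assoc _ _ _)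
    ((hU.dec (W.tensor X)).sum_map_tensor_right LinearMap.id S B (C ⊠ D)).symm)
  rw [LinearMap.id_apply, QRep.Mor.comp_assoc, QRep.Mor.assoc_naturality]
  rfl

theorem bilin_assoc {V W X : QRep O} {δ : I} (S : QRep.Mor (V.tensor (W.tensor X)) (U δ))
    (x : (hU.obj M V).E) (y : (hU.obj M W).E) (w : (hU.obj M X).E) :
    hU.bilin φ (S ⊚ QRep.Mor.assoc V W X) (hU.mul φ V W x y) w
      = hU.bilin φ S x (hU.mul φ W X y w) := by
  simp only [bilin_apply, component_mul, map_sum, LinearMap.sum_apply]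
  rw [Fintype.sum_reorder_four]
  refine Finset.sum_congr rfl fun i _ => ?_
  conv_rhs => rw [Fintype.sum_rotate_three]
  exact Finset.sum_congr rfl fun l _ => Finset.sum_congr rfl fun p _ =>
    hU.sum_ev_assoc hφ S _ _ _ _ _ _

theorem mul_assoc (V W X : QRep O) (x : (hU.obj M V).E) (y : (hU.obj M W).E)
    (w : (hU.obj M X).E) :
    hU.map (QRep.Mor.assoc V W X) (hU.mul φ (V.tensor W) X (hU.mul φ V W x y) w)
      = hU.mul φ V (W.tensor X) x (hU.mul φ W X y w) :=
  hU.obj_ext fun k => by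
    rw [component_map, coord_mul, component_mul, hU.bilin_assoc hφ]

/-- By naturality of the unit isomorphism, each term is `proj k ∘ emb i` applied to an instance of
(iii) for an irreducible. -/
theorem mul_unit_left (V : QRep O) (a : A) (x : (hU.obj M V).E) :
    hU.map (QRep.Mor.lunit V) (hU.mul φ (QRep.one O) V (hU.incl t (j.toEquiv a)) x)
      = (hU.obj M V).lact a x := by
  refine hU.obj_ext fun k => ?_
  rw [component_map, coord_mul, bilin_incl_left, ← coord_proj, coord_lact, coord_apply, map_sum]
  refine Finset.sum_congr rfl fun i _ => ?_
  have h : ((hU.dec V).proj k ⊚ QRep.Mor.lunit V) ⊚ (t ⊠ (hU.dec V).emb i)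
      = ((hU.dec V).proj k ⊚ (hU.dec V).emb i) ⊚
        (QRep.Mor.lunit _ ⊚ (t ⊠ QRep.Mor.id _)) := by
    have h' : t ⊠ (hU.dec V).emb i = (QRep.Mor.id _ ⊠ (hU.dec V).emb i) ⊚ (t ⊠ QRep.Mor.id _) := by
      rw [← QRep.Mor.tensor_comp, QRep.Mor.id_comp, QRep.Mor.comp_id]
    rw [h', ← QRep.Mor.comp_assoc, QRep.Mor.comp_assoc _ (QRep.Mor.lunit _),
      QRep.Mor.lunit_naturality]
    rfl
  rw [h, φ.ev_comp hU, ← irrMap_lact hU]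
  exact congrArg _ (hφ.unit_left _ a _)

theorem mul_unit_right (V : QRep O) (x : (hU.obj M V).E) (a : A) :
    hU.map (QRep.Mor.runit V) (hU.mul φ V (QRep.one O) x (hU.incl t (j.toEquiv a)))
      = (hU.obj M V).ract x a := by
  refine hU.obj_ext fun k => ?_
  rw [component_map, coord_mul, bilin_incl_right, ← coord_proj, coord_ract, coord_apply, map_sum,
    LinearMap.sum_apply]
  refine Finset.sum_congr rfl fun i _ => ?_
  have h : ((hU.dec V).proj k ⊚ QRep.Mor.runit V) ⊚ ((hU.dec V).emb i ⊠ t)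
      = ((hU.dec V).proj k ⊚ (hU.dec V).emb i) ⊚
        (QRep.Mor.runit _ ⊚ (QRep.Mor.id _ ⊠ t)) := by
    have h' : (hU.dec V).emb i ⊠ t = ((hU.dec V).emb i ⊠ QRep.Mor.id _) ⊚ (QRep.Mor.id _ ⊠ t) := by
      rw [← QRep.Mor.tensor_comp, QRep.Mor.id_comp, QRep.Mor.comp_id]
    rw [h', ← QRep.Mor.comp_assoc, QRep.Mor.comp_assoc _ (QRep.Mor.runit _),
      QRep.Mor.runit_naturality]
    rfl
  rw [h, φ.ev_comp hU, ← irrMap_ract hU]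
  exact congrArg _ (hφ.unit_right _ _ a)

/-- The adjoint of `y ↦ F₂(x ⊗ y)`. -/
noncomputable def mulAdj {V W : QRep O} (x : (hU.obj M V).E) (y : (hU.obj M (V.tensor W)).E) :
    (hU.obj M W).E := fun l =>
  ∑ i, ∑ k, hφ.evAdj ((hU.dec (V.tensor W)).proj k ⊚ ((hU.dec V).emb i ⊠ (hU.dec W).emb l))
    (hU.component V i x) (hU.component (V.tensor W) k y)

theorem component_mulAdj {V W : QRep O} (x : (hU.obj M V).E) (y : (hU.obj M (V.tensor W)).E)
    (l : Fin (hU.size W)) :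
    hU.component W l (hU.mulAdj hφ x y) = ∑ i, ∑ k, hφ.evAdj ((hU.dec (V.tensor W)).proj k ⊚
      ((hU.dec V).emb i ⊠ (hU.dec W).emb l)) (hU.component V i x)
        (hU.component (V.tensor W) k y) := rfl

/-- The operator `y ↦ F₂(x ⊗ y)` is a finite matrix whose entries have adjoints by (v), and `mulAdj`
is the transposed matrix of adjoints. -/
theorem isAdjoint_mulAdj {V W : QRep O} (x : (hU.obj M V).E) :
    Corr.IsAdjoint (hU.obj M W) (hU.obj M (V.tensor W)) (hU.mul φ V W x) (hU.mulAdj hφ x) := by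
  intro y w
  simp only [obj_inner, component_mul, component_mulAdj, bilin_apply, map_sum,
    LinearMap.sum_apply]
  rw [Fintype.sum_rotate_three, Finset.sum_comm]
  exact Finset.sum_congr rfl fun l _ => Finset.sum_congr rfl fun i _ =>
    Finset.sum_congr rfl fun k _ => hφ.inner_evAdj _ _ _ _

/-- Condition (v) with `T_l = C*(B ⊗ emb l)`, `S_l = E*(emb l ⊗ D)`, `R_k = proj k ∘ assoc ∘ (C ⊗
D)` and `P_k = proj k ∘ (B ⊗ E)`. Both sums in its premise equal `(B* ⊗ E*) ∘ assoc ∘ (C ⊗ D)`. -/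
theorem sum_evAdj_ev {V W X : QRep O} {α γ δ η : I} (B : QRep.Mor (U α) V)
    (C : QRep.Mor (U γ) (V.tensor W)) (D : QRep.Mor (U δ) X) (E : QRep.Mor (U η) (W.tensor X))
    (x : (M α).E) (y : (M γ).E) (w : (M δ).E) :
    ∑ l, φ.ev (QRep.Mor.adj E ⊚ ((hU.dec W).emb l ⊠ D))
        (hφ.evAdj (QRep.Mor.adj C ⊚ (B ⊠ (hU.dec W).emb l)) x y) w
      = ∑ k, hφ.evAdj ((hU.dec (V.tensor (W.tensor X))).proj k ⊚ (B ⊠ E)) x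
        (φ.ev (((hU.dec (V.tensor (W.tensor X))).proj k ⊚ QRep.Mor.assoc V W X) ⊚ (C ⊠ D)) y w) := by
  set d := hU.dec (V.tensor (W.tensor X)) with hd
  refine hφ.adjoint_mul α γ δ η _ _ _ _
    (fun l => QRep.Mor.adj C ⊚ (B ⊠ (hU.dec W).emb l))
    (fun l => QRep.Mor.adj E ⊚ ((hU.dec W).emb l ⊠ D))
    (fun k => (d.proj k ⊚ QRep.Mor.assoc V W X) ⊚ (C ⊠ D))
    (fun k => d.proj k ⊚ (B ⊠ E)) ?_ x (fun l => hφ.evAdj _ x) (fun k => hφ.evAdj _ x)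
    (fun l => hφ.inner_evAdj _ x) (fun k => hφ.inner_evAdj _ x) y w
  have h1 : ∀ l, (QRep.Mor.id (U α) ⊠ (QRep.Mor.adj E ⊚ ((hU.dec W).emb l ⊠ D))) ⊚
      QRep.Mor.assoc (U α) (U ((hU.dec W).idx l)) (U δ) ⊚
        (QRep.Mor.adj (QRep.Mor.adj C ⊚ (B ⊠ (hU.dec W).emb l)) ⊠ QRep.Mor.id (U δ))
      = (QRep.Mor.id (U α) ⊠ QRep.Mor.adj E) ⊚ QRep.Mor.assoc (U α) W X ⊚
        (((QRep.Mor.adj B ⊠ ((hU.dec W).emb l ⊚ (hU.dec W).proj l)) ⊚ C) ⊠ D) := fun l => by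
    have h : QRep.Mor.id (U α) ⊠ (QRep.Mor.adj E ⊚ ((hU.dec W).emb l ⊠ D))
        = (QRep.Mor.id (U α) ⊠ QRep.Mor.adj E) ⊚
          (QRep.Mor.id (U α) ⊠ ((hU.dec W).emb l ⊠ D)) := by
      rw [← QRep.Mor.tensor_comp, QRep.Mor.id_comp]
    rw [h, QRep.Mor.comp_assoc, ← QRep.Mor.comp_assoc _ (QRep.Mor.assoc _ _ _),
      ← QRep.Mor.assoc_naturality, QRep.Mor.comp_assoc, ← QRep.Mor.tensor_comp, QRep.Mor.comp_id,
      QRep.Mor.adj_comp, QRep.Mor.adj_adj, QRep.Mor.adj_tensor,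
      ← QRep.Mor.comp_assoc (QRep.Mor.id _ ⊠ (hU.dec W).emb l), ← QRep.Mor.tensor_comp,
      QRep.Mor.id_comp]
    rfl
  have h2 : ∀ k, QRep.Mor.adj (d.proj k ⊚ (B ⊠ E)) ⊚
      (d.proj k ⊚ QRep.Mor.assoc V W X) ⊚ (C ⊠ D)
      = (QRep.Mor.adj B ⊠ QRep.Mor.adj E) ⊚ d.emb k ⊚ d.proj k ⊚
        (QRep.Mor.assoc V W X ⊚ (C ⊠ D)) := fun k => by
    rw [QRep.Mor.adj_comp, QRep.Mor.adj_tensor, IrrepDecomposition.adj_proj]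
    rfl
  simp only [h1, h2]
  refine Eq.trans ?_ (d.sum_map_comp LinearMap.id _ _).symm
  rw [← QRep.Mor.comp_sum, ← QRep.Mor.comp_sum, ← QRep.Mor.sum_tensor, ← QRep.Mor.sum_comp,
    ← QRep.Mor.tensor_sum, IrrepDecomposition.sum_emb_proj, LinearMap.id_apply]
  have h3 : ((QRep.Mor.adj B ⊠ QRep.Mor.id W) ⊚ C) ⊠ D
      = ((QRep.Mor.adj B ⊠ QRep.Mor.id W) ⊠ QRep.Mor.id X) ⊚ (C ⊠ D) := by
    rw [← QRep.Mor.tensor_comp, QRep.Mor.id_comp]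
  rw [h3, ← QRep.Mor.comp_assoc (QRep.Mor.assoc _ _ _), QRep.Mor.assoc_naturality,
    QRep.Mor.comp_assoc, ← QRep.Mor.comp_assoc (QRep.Mor.id _ ⊠ _), ← QRep.Mor.tensor_comp,
    QRep.Mor.id_tensor_id, QRep.Mor.comp_id, QRep.Mor.id_comp]

theorem mulAdj_assoc_mul {V W X : QRep O} (x : (hU.obj M V).E) (y : (hU.obj M (V.tensor W)).E)
    (w : (hU.obj M X).E) :
    hU.mulAdj hφ x (hU.map (QRep.Mor.assoc V W X) (hU.mul φ (V.tensor W) X y w))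
      = hU.mul φ W X (hU.mulAdj hφ x y) w := by
  refine hU.obj_ext fun q => ?_
  simp only [component_mul, component_mulAdj, component_map, coord_mul, bilin_apply, map_sum,
    LinearMap.sum_apply]
  conv_rhs => rw [Fintype.sum_reorder_four]
  refine Finset.sum_congr rfl fun i _ => ?_
  rw [Fintype.sum_rotate_three]
  refine Finset.sum_congr rfl fun m _ => Finset.sum_congr rfl fun p _ => ?_
  -- Entry by entry, the identity is (v) for the embeddings of the summands.
  exact (hU.sum_evAdj_ev hφ ((hU.dec V).emb i) ((hU.dec (V.tensor W)).emb m)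
    ((hU.dec X).emb p) ((hU.dec (W.tensor X)).emb q) _ _ _).symm

/-- The weak unitary tensor functor defined by a coherent system. -/
noncomputable def tensorFunctor (ht : QRep.Mor.IsUnitary t) :
    WeakUnitaryTensorFunctor.{u, v, z} O A where
  obj := hU.obj M
  map := hU.mapMor
  map_id := hU.map_id
  map_comp := hU.map_comp
  map_adj T := hU.inner_map T
  unit := j.trans (hU.inclIso t ht)
  mul := hU.mul φ
  mul_isometric := hU.mul_isometric hφ
  mul_natural S T x y := hU.map_tensor_mul φ S T x y
  mul_unit_left := hU.mul_unit_left hφ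
  mul_unit_right := hU.mul_unit_right hφ
  mul_assoc := hU.mul_assoc hφ
  adjointable V W x := ⟨_, hU.isAdjoint_mulAdj hφ x⟩
  adjoint_mul V W X x g g' hg hg' y w := by
    rw [Corr.IsAdjoint.unique hg (hU.isAdjoint_mulAdj hφ x),
      Corr.IsAdjoint.unique hg' (hU.isAdjoint_mulAdj hφ x)]
    exact hU.mulAdj_assoc_mul hφ x y w

omit hφ in
-- `F(U_α)` is formed from a chosen decomposition of `U_α`, so it is only isomorphic to `M_α`. The
-- coordinate of the identity morphism is this isomorphism.
theorem coord_map_mul (α β γ : I) (T : QRep.Mor ((U α).tensor (U β)) (U γ))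
    (x : (hU.obj M (U α)).E) (y : (hU.obj M (U β)).E) :
    hU.coord (QRep.Mor.adj (QRep.Mor.id _)) (hU.map T (hU.mul φ _ _ x y))
      = φ.ev T (hU.coord (QRep.Mor.adj (QRep.Mor.id _)) x)
        (hU.coord (QRep.Mor.adj (QRep.Mor.id _)) y) := by
  rw [QRep.Mor.adj_id, QRep.Mor.adj_id, QRep.Mor.adj_id, coord_map, QRep.Mor.id_comp, coord_mul]
  have hx : ∀ {α : I} (x : (hU.obj M (U α)).E),
      hU.incl (QRep.Mor.id (U α)) (hU.coord (QRep.Mor.id (U α)) x) = x := fun x => by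
    rw [incl_coord, QRep.Mor.comp_id, map_id]
  conv_lhs => rw [← hx x, ← hx y]
  rw [bilin_incl_incl, QRep.Mor.id_tensor_id, QRep.Mor.comp_id]

theorem extends_tensorFunctor (ht : QRep.Mor.IsUnitary t) :
    (hU.tensorFunctor hφ ht).Extends
      (fun α => (hU.inclIso (M := M) (QRep.Mor.id (U α))
        ⟨by rw [QRep.Mor.adj_id]; rfl, by rw [QRep.Mor.adj_id]; rfl⟩).symm) φ e t j where
  map_mul := hU.coord_map_mul
  unit a := by
    change hU.coord (QRep.Mor.adj (QRep.Mor.id _)) (hU.map (QRep.Mor.adj t)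
      (hU.incl t (j.toEquiv a))) = j.toEquiv a
    rw [QRep.Mor.adj_id, map_incl, coord_incl, QRep.Mor.id_comp, ht.1, irrMap_id hU]

end IsIrreducibleSystem

end Existence

/-! ### Uniqueness up to monoidal unitary isomorphism -/

section Uniqueness

universe u v w z

variable {O : Type u} [Ring O] [StarRing O] [HopfAlgebra ℂ O] [StarModule ℂ O]
  {A : Type v} [NonUnitalCStarAlgebra A] [PartialOrder A] [StarOrderedRing A]
  {I : Type w} {U : I → QRep O} {M : I → Corr.{v, z} A}

namespace WeakUnitaryTensorFunctor

variable (F F' : WeakUnitaryTensorFunctor.{u, v, z} O A)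

/-- `F(T)` as a linear map, linear in `T`. -/
noncomputable def lin {V W : QRep O} :
    QRep.Mor V W →ₗ[ℂ] (F.obj V).E →ₗ[ℂ] (F.obj W).E :=
  (Corr.Mor (F.obj V) (F.obj W)).subtype ∘ₗ F.map

theorem lin_id (V : QRep O) (x : (F.obj V).E) : F.lin (QRep.Mor.id V) x = x := F.map_id V x

theorem lin_comp {V W X : QRep O} (S : QRep.Mor W X) (T : QRep.Mor V W) (x : (F.obj V).E) :
    F.lin (S ⊚ T) x = F.lin S (F.lin T x) := F.map_comp S T x

theorem inner_lin {V W : QRep O} (T : QRep.Mor V W) (x : (F.obj V).E) (y : (F.obj W).E) :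
    (F.obj W).inner (F.lin T x) y = (F.obj V).inner x (F.lin (QRep.Mor.adj T) y) :=
  F.map_adj T x y

theorem lin_lact {V W : QRep O} (T : QRep.Mor V W) (a : A) (x : (F.obj V).E) :
    F.lin T ((F.obj V).lact a x) = (F.obj W).lact a (F.lin T x) := (F.map T).2.1 a x

theorem lin_ract {V W : QRep O} (T : QRep.Mor V W) (x : (F.obj V).E) (a : A) :
    F.lin T ((F.obj V).ract x a) = (F.obj W).ract (F.lin T x) a := (F.map T).2.2.1 x a

theorem lin_tensor_mul {V W V' W' : QRep O} (S : QRep.Mor V V') (T : QRep.Mor W W')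
    (x : (F.obj V).E) (y : (F.obj W).E) :
    F.lin (S ⊠ T) (F.mul V W x y) = F.mul V' W' (F.lin S x) (F.lin T y) :=
  F.mul_natural S T x y

variable {F F'} (hU : IsIrreducibleSystem U)
  (θ : ∀ α, Corr.UnitaryIso (F.obj (U α)) (F'.obj (U α)))

/-- The extension of a family of maps `F(U_α) → F'(U_α)` to all representations. -/
noncomputable def extend (V : QRep O) : (F.obj V).E →ₗ[ℂ] (F'.obj V).E :=
  ∑ k, F'.lin ((hU.dec V).emb k) ∘ₗ (θ ((hU.dec V).idx k)).toEquiv.toLinearMap ∘ₗ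
    F.lin ((hU.dec V).proj k)

theorem extend_apply (V : QRep O) (x : (F.obj V).E) :
    extend hU θ V x = ∑ k, F'.lin ((hU.dec V).emb k)
      ((θ ((hU.dec V).idx k)).toEquiv (F.lin ((hU.dec V).proj k) x)) := by
  simp [extend]

include hU in
-- Morphisms between irreducibles act as zero or as scalars, so any family `θ` commutes with them.
theorem lin_naturality {α β : I} (S : QRep.Mor (U α) (U β)) (x : (F.obj (U α)).E) :
    F'.lin S ((θ α).toEquiv x) = (θ β).toEquiv (F.lin S x) :=
  hU.schur (motive := fun α β S => ∀ x : (F.obj (U α)).E,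
      F'.lin S ((θ α).toEquiv x) = (θ β).toEquiv (F.lin S x))
    (fun α β x => by simp) (fun α c x => by
      rw [map_smul, map_smul, LinearMap.smul_apply, LinearMap.smul_apply, lin_id, lin_id,
        map_smul]) S x

theorem sum_lin_comp {V X Y : QRep O} {ι : Type} [Fintype ι] (d : IrrepDecomposition U V ι)
    (S : QRep.Mor V Y) (T : QRep.Mor X V) (x : (F.obj X).E) :
    ∑ k, F.lin (S ⊚ d.emb k ⊚ d.proj k ⊚ T) x = F.lin (S ⊚ T) x :=
  d.sum_map_comp (LinearMap.applyₗ x ∘ₗ F.lin : QRep.Mor X Y →ₗ[ℂ] (F.obj Y).E) S T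

/-- This formula determines the extension without reference to the chosen decomposition. Combined
with `induction_on`, it reduces the properties of the extension to properties of `θ` on
irreducibles. -/
theorem extend_lin {α : I} {V : QRep O} (T : QRep.Mor (U α) V) (x : (F.obj (U α)).E) :
    extend hU θ V (F.lin T x) = F'.lin T ((θ α).toEquiv x) := by
  have h := sum_lin_comp (hU.dec V) (QRep.Mor.id V) T ((θ α).toEquiv x)
  rw [QRep.Mor.id_comp] at h
  rw [extend_apply, ← h]
  refine Finset.sum_congr rfl fun k _ => ?_
  rw [← lin_comp, ← lin_naturality hU θ, ← lin_comp, QRep.Mor.id_comp]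

/-- `F(V)` is spanned by the images of the `F(U_α)`. -/
theorem sum_lin_emb_proj {V : QRep O} (x : (F.obj V).E) :
    ∑ k, F.lin ((hU.dec V).emb k) (F.lin ((hU.dec V).proj k) x) = x := by
  simp only [← lin_comp]
  exact (sum_lin_comp (hU.dec V) (QRep.Mor.id V) (QRep.Mor.id V) x).trans (F.lin_id V x)

include hU in
theorem induction_on {V : QRep O} {motive : (F.obj V).E → Prop} (x : (F.obj V).E)
    (zero : motive 0) (add : ∀ x y, motive x → motive y → motive (x + y))
    (lin : ∀ (α : I) (T : QRep.Mor (U α) V) (x : (F.obj (U α)).E), motive (F.lin T x)) :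
    motive x := by
  rw [← sum_lin_emb_proj hU x]
  exact Finset.sum_induction _ motive add zero fun k _ => lin _ _ _

theorem extend_naturality {V W : QRep O} (T : QRep.Mor V W) (x : (F.obj V).E) :
    extend hU θ W (F.lin T x) = F'.lin T (extend hU θ V x) := by
  induction x using induction_on hU with
  | zero => simp
  | add x y hx hy => simp only [map_add, hx, hy]
  | lin α S x => rw [← lin_comp, extend_lin, extend_lin, lin_comp]

theorem extend_symm_extend (V : QRep O) (x : (F.obj V).E) :
    extend hU (fun α => (θ α).symm) V (extend hU θ V x) = x := by
  induction x using induction_on hU with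
  | zero => simp
  | add x y hx hy => simp only [map_add, hx, hy]
  | lin α S x =>
    rw [extend_lin, extend_lin]
    exact congrArg _ ((θ α).toEquiv.symm_apply_apply x)

/-- On spanning vectors `⟨F(S)x, F(T)y⟩ = ⟨x, F(S*T)y⟩`, and `S*T` is a morphism between
irreducibles, with which the isometric `θ` commutes. -/
theorem inner_extend {V : QRep O} (x y : (F.obj V).E) :
    (F'.obj V).inner (extend hU θ V x) (extend hU θ V y) = (F.obj V).inner x y := by
  induction x using induction_on hU with
  | zero => simp
  | add x x' hx hx' => simp only [map_add, LinearMap.add_apply, hx, hx']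
  | lin α S x =>
    induction y using induction_on hU with
    | zero => simp
    | add y y' hy hy' => simp only [map_add, hy, hy']
    | lin β T y =>
      rw [extend_lin, extend_lin, inner_lin, inner_lin, ← lin_comp, ← lin_comp,
        lin_naturality hU θ, (θ α).map_inner]

theorem extend_lact {V : QRep O} (a : A) (x : (F.obj V).E) :
    extend hU θ V ((F.obj V).lact a x) = (F'.obj V).lact a (extend hU θ V x) := by
  induction x using induction_on hU with
  | zero => simp
  | add x y hx hy => simp only [map_add, hx, hy]
  | lin α S x => rw [← lin_lact, extend_lin, extend_lin, (θ α).map_lact, lin_lact]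

theorem extend_ract {V : QRep O} (x : (F.obj V).E) (a : A) :
    extend hU θ V ((F.obj V).ract x a) = (F'.obj V).ract (extend hU θ V x) a := by
  induction x using induction_on hU with
  | zero => simp
  | add x y hx hy => simp only [map_add, LinearMap.add_apply, hx, hy]
  | lin α S x => rw [← lin_ract, extend_lin, extend_lin, (θ α).map_ract, lin_ract]

/-- The unitary isomorphism `F(V) → F'(V)` that extends the given ones on the `F(U_α)`. -/
noncomputable def extendIso (V : QRep O) : Corr.UnitaryIso (F.obj V) (F'.obj V) where
  toEquiv := LinearEquiv.ofLinearMap (extend hU θ V) (extend hU (fun α => (θ α).symm) V)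
    (LinearMap.ext fun x => extend_symm_extend hU (fun α => (θ α).symm) V x)
    (LinearMap.ext fun x => extend_symm_extend hU θ V x)
  map_lact := extend_lact hU θ
  map_ract := extend_ract hU θ
  map_inner := inner_extend hU θ

/-- Naturality of `F₂` reduces the claim to `V = U_α` and `W = U_β`. There `F₂(x ⊗ y)` is recovered
from its images under the projections onto the summands of `U_α × U_β`, on which `hθ` applies. -/
theorem extend_mul
    (hθ : ∀ (α β γ : I) (T : QRep.Mor ((U α).tensor (U β)) (U γ)) (x : (F.obj (U α)).E)
      (y : (F.obj (U β)).E), (θ γ).toEquiv (F.lin T (F.mul (U α) (U β) x y))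
        = F'.lin T (F'.mul (U α) (U β) ((θ α).toEquiv x) ((θ β).toEquiv y)))
    (V W : QRep O) (x : (F.obj V).E) (y : (F.obj W).E) :
    extend hU θ (V.tensor W) (F.mul V W x y)
      = F'.mul V W (extend hU θ V x) (extend hU θ W y) := by
  induction x using induction_on hU with
  | zero => simp
  | add x x' hx hx' => simp only [map_add, LinearMap.add_apply, hx, hx']
  | lin α S x =>
    induction y using induction_on hU with
    | zero => simp
    | add y y' hy hy' => simp only [map_add, hy, hy']
    | lin β T y =>
      rw [← lin_tensor_mul, extend_naturality, extend_lin, extend_lin, ← lin_tensor_mul,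
        extend_apply]
      simp only [hθ]
      rw [sum_lin_emb_proj hU]

include hU in
theorem exists_monoidalUnitaryIso (φ : BilinSystem U M) {e : I}
    {t : QRep.Mor (U e) (QRep.one O)} (ht : QRep.Mor.IsUnitary t)
    {j : Corr.UnitaryIso (Corr.self A) (M e)}
    {i : ∀ α, Corr.UnitaryIso (F.obj (U α)) (M α)}
    {i' : ∀ α, Corr.UnitaryIso (F'.obj (U α)) (M α)} (hF : F.Extends i φ e t j)
    (hF' : F'.Extends i' φ e t j) :
    ∃ η : MonoidalUnitaryIso F F', ∀ (α : I) (x : (F.obj (U α)).E),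
      (i' α).toEquiv ((η.app (U α)).toEquiv x) = (i α).toEquiv x := by
  let θ : ∀ α, Corr.UnitaryIso (F.obj (U α)) (F'.obj (U α)) := fun α => (i α).trans (i' α).symm
  have hθ : ∀ α x, (i' α).toEquiv ((θ α).toEquiv x) = (i α).toEquiv x := fun α x =>
    (i' α).toEquiv.apply_symm_apply _
  refine ⟨{ app := extendIso hU θ
            natural := extend_naturality hU θ
            map_mul := extend_mul hU θ fun α β γ T x y => (i' γ).toEquiv.injective ?_
            map_unit := fun a => ?_ }, fun α x => ?_⟩
  · rw [hθ]
    refine (hF.map_mul α β γ T x y).trans ?_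
    rw [← hθ, ← hθ β]
    exact (hF'.map_mul α β γ T _ _).symm
  · change extend hU θ _ (F.unit.toEquiv a) = F'.unit.toEquiv a
    -- Units live in `F(𝟙)`, while the compatibility with `j` is stated on `F(U_e)`; the unitary `t`
    -- carries one to the other.
    have h : ∀ (G : WeakUnitaryTensorFunctor.{u, v, z} O A) (x : (G.obj (QRep.one O)).E),
        G.lin t (G.lin (QRep.Mor.adj t) x) = x := fun G x => by
      rw [← lin_comp, ht.2, lin_id]
    rw [← h F (F.unit.toEquiv a), extend_lin, ← h F' (F'.unit.toEquiv a)]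
    refine congrArg _ ((i' e).toEquiv.injective ?_)
    rw [hθ]
    exact (hF.unit a).trans (hF'.unit a).symm
  · rw [← hθ]
    refine congrArg _ ?_
    have h := extend_lin hU θ (QRep.Mor.id (U α)) x
    rw [lin_id, lin_id] at h
    exact h

end WeakUnitaryTensorFunctor

end Uniqueness

theorem proposition4p1 {O : Type*} [Ring O] [StarRing O] [HopfAlgebra ℂ O] [StarModule ℂ O]
    [CompactQuantumGroup O] {A : Type*} [NonUnitalCStarAlgebra A] [PartialOrder A]
    [StarOrderedRing A] {I : Type*} (U : I → QRep O) (hU : IsIrreducibleSystem U)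
    (e : I) (t : QRep.Mor (U e) (QRep.one O)) (ht : QRep.Mor.IsUnitary t)
    (M : I → Corr A) (j : Corr.UnitaryIso (Corr.self A) (M e))
    (φ : BilinSystem U M) (hφ : φ.IsCoherent e t j) :
    (∃ (F : WeakUnitaryTensorFunctor O A) (i : ∀ α, Corr.UnitaryIso (F.obj (U α)) (M α)),
      F.Extends i φ e t j) ∧
    ∀ (F F' : WeakUnitaryTensorFunctor O A) (i : ∀ α, Corr.UnitaryIso (F.obj (U α)) (M α))
      (i' : ∀ α, Corr.UnitaryIso (F'.obj (U α)) (M α)),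
      F.Extends i φ e t j → F'.Extends i' φ e t j →
      ∃ η : MonoidalUnitaryIso F F', ∀ (α : I) (x : (F.obj (U α)).E),
        (i' α).toEquiv ((η.app (U α)).toEquiv x) = (i α).toEquiv x := by
  exact ⟨⟨hU.tensorFunctor hφ ht, _, hU.extends_tensorFunctor hφ ht⟩, fun F F' i i' hF hF' =>
    WeakUnitaryTensorFunctor.exists_monoidalUnitaryIso hU φ ht hF hF'⟩
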